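/- In the domination game on a finite graph $G$, Dominator and Staller alternately choose vertices so that each chosen vertex $u$ dominates (through its closed neighbourhood $N[u]$) at least one vertex that was not dominated before; the game ends when all vertices are dominated. Dominator wants as few moves as possible, Staller as many as possible. Let $\gamma_g'(G)$ be the total number of moves under optimal play when Staller moves first. **Proposition.** For every integer $\ell\ge 4$ there exist a connected graph $G$ and a vertex $v$ of $G$ such that $\gamma_g'(G)=\ell$ and $\gamma_g'(G-v)=\ell-2$. More precisely, the following connected graphs realize all these values. Let $Z$ be the graph with vertices $0,1,\dots,8$ and edges $01,12,23,38,87,76,65,50,16,74,43,48,27$, and put $z=8$. Let $S$ be obtained from $K_{1,3}$ with centre $x$ by subdividing one edge, and let $v$ be the vertex of $S$ at distance $2$ from $x$. For $k\ge 0$ let $Z_k$ be obtained from the disjoint union of $Z$ and $S$ by adding the edge $zx$ and identifying one end vertex of each of $k$ copies of the path $P_6$ on six vertices with $x$; let $W_k$ be obtained in the same way with $Z$ replaced by the cycle $C_6$ and $z$ any of its vertices. Then for every $k\ge 0$: - $\gamma_g'(Z_k)=2k+7$ and $\gamma_g'(Z_k-v)=2k+5$; - $\gamma_g'(W_k)=2k+6$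 and $\gamma_g'(W_k-v)=2k+4$; - if $H$ is obtained from $C_6$ by attaching a leaf $v$ to any vertex, then $\gamma_g'(H)=4$ and $\gamma_g'(H-v)=2$; - if $H'$ is obtained from $Z$ by attaching a leaf $v$ to $z$, then $\gamma_g'(H')=5$ and $\gamma_g'(H'-v)=3$. -/

import Mathlib

/-- The closed neighbourhood `N[u]` of a vertex `u`, as a finset. -/
def closedNbhd {V : Type*} [Fintype V] [DecidableEq V] (G : SimpleGraph V) [DecidableRel G.Adj]
    (u : V) : Finset V :=
  insert u (G.neighborFinset u)

/-- The legal moves when `D` is the set of vertices dominated so far: the vertices whose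
closed neighbourhood contains at least one undominated vertex. -/
def legalMoves {V : Type*} [Fintype V] [DecidableEq V] (G : SimpleGraph V) [DecidableRel G.Adj]
    (D : Finset V) : Finset V :=
  Finset.univ.filter fun u => ¬ closedNbhd G u ⊆ D

theorem card_compl_union_closedNbhd_lt {V : Type*} [Fintype V] [DecidableEq V]
    (G : SimpleGraph V) [DecidableRel G.Adj] {D : Finset V} {u : V} (hu : u ∈ legalMoves G D) :
    (D ∪ closedNbhd G u)ᶜ.card < Dᶜ.card := by
  have hu' : ¬ closedNbhd G u ⊆ D := (Finset.mem_filter.1 hu).2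
  obtain ⟨w, hw, hwD⟩ := Finset.not_subset.1 hu'
  refine Finset.card_lt_card (Finset.ssubset_iff_of_subset ?_ |>.2 ⟨w, ?_, ?_⟩)
  · exact Finset.compl_subset_compl.2 Finset.subset_union_left
  · simpa using hwD
  · simp [hw]

/-- The number of moves, under optimal play, that remain in the domination game on `G` when `D` is
the set of vertices dominated so far. The flag says who moves next: `true` for Staller, who
maximizes the number of moves, `false` for Dominator, who minimizes it. The game is over when
there is no legal move, i.e. when every vertex is dominated. -/
def gameLength {V : Type*} [Fintype V] [DecidableEq V] (G : SimpleGraph V) [DecidableRel G.Adj]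
    (stallerMoves : Bool) (D : Finset V) : ℕ :=
  if h : (legalMoves G D).Nonempty then
    if stallerMoves then
      1 + (legalMoves G D).attach.sup' ((Finset.attach_nonempty_iff).2 h)
        (fun u => gameLength G false (D ∪ closedNbhd G u.1))
    else
      1 + (legalMoves G D).attach.inf' ((Finset.attach_nonempty_iff).2 h)
        (fun u => gameLength G true (D ∪ closedNbhd G u.1))
  else 0
termination_by Dᶜ.card
decreasing_by
  all_goals exact card_compl_union_closedNbhd_lt G u.2

/-- The Staller-start game domination number `γ_g'(G)`. -/
def stallerStartGameDomNumber {V : Type*} [Fintype V] [DecidableEq V] (G : SimpleGraph V)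
    [DecidableRel G.Adj] : ℕ :=
  gameLength G true ∅

/-- The vertex-deleted subgraph `G - v`. -/
abbrev removeVertex {V : Type*} (G : SimpleGraph V) (v : V) : SimpleGraph {w : V // w ≠ v} :=
  G.comap Subtype.val

/-- The edge list of the graph `Z`; the vertices `0, 1, 2, 3` form the bottom row, the vertices
`5, 6, 7, 8` the top row (each from left to right), and `4` lies inside the square `2, 3, 8, 7`. -/
def edgesZ : List (Fin 9 × Fin 9) :=
  [(0, 1), (1, 2), (2, 3), (3, 8), (8, 7), (7, 6), (6, 5), (5, 0),
   (6, 1), (7, 4), (4, 3), (4, 8), (2, 7)]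

/-- The graph `Z` on nine vertices; its distinguished vertex `z` is `8`. -/
def graphZ : SimpleGraph (Fin 9) where
  Adj a b := (a, b) ∈ edgesZ ∨ (b, a) ∈ edgesZ
  symm := ⟨fun _ _ h => h.symm⟩
  loopless := ⟨by decide⟩

instance instDecidableRelGraphZ : DecidableRel graphZ.Adj := fun a b =>
  inferInstanceAs (Decidable ((a, b) ∈ edgesZ ∨ (b, a) ∈ edgesZ))

/-- The graph obtained from `H` by attaching one leaf, `none`, to the vertex `z`. -/
def attachLeaf {A : Type*} (H : SimpleGraph A) (z : A) : SimpleGraph (Option A) where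
  Adj
    | some a, some b => H.Adj a b
    | some a, none => a = z
    | none, some b => b = z
    | none, none => False
  symm := ⟨by
    rintro (_ | a) (_ | b) h
    · exact h
    · exact h
    · exact h
    · exact SimpleGraph.Adj.symm h⟩
  loopless := ⟨by
    rintro (_ | a) h
    · exact h
    · exact H.irrefl h⟩

instance instDecidableRelAttachLeaf {A : Type*} [DecidableEq A] (H : SimpleGraph A)
    [DecidableRel H.Adj] (z : A) : DecidableRel (attachLeaf H z).Adj
  | some a, some b => inferInstanceAs (Decidable (H.Adj a b))
  | some a, none => inferInstanceAs (Decidable (a = z))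
  | none, some b => inferInstanceAs (Decidable (b = z))
  | none, none => inferInstanceAs (Decidable False)

/-- Vertices of the graph obtained from a graph on `A` by attaching `S` and `k` pendant paths:
the vertices of `A`, the five vertices of `S` and, for each of the `k` copies of `P₆` whose first
vertex is identified with `x`, its five further vertices. In `S`, the vertex `0` is the centre `x`
of `K_{1,3}`, the vertices `1` and `2` are the leaves adjacent to `x`, the vertex `3` subdivides
the third edge, and the vertex `4` is the remaining leaf `v`. -/
abbrev GadgetVertex (A : Type*) (k : ℕ) : Type _ := A ⊕ Fin 5 ⊕ (Fin k × Fin 5)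

/-- The edges of the graph with base graph `H`, each listed in at least one orientation: those of
`H`, the edge `zx`, those of `S`, and those of the `k` paths starting at `x`. -/
def gadgetRel {A : Type*} (H : SimpleGraph A) (z : A) (k : ℕ) :
    GadgetVertex A k → GadgetVertex A k → Prop
  | .inl a, .inl b => H.Adj a b
  | .inl a, .inr (.inl s) => a = z ∧ s = 0
  | .inr (.inl s), .inr (.inl t) => (s, t) ∈ [((0 : Fin 5), (1 : Fin 5)), (0, 2), (0, 3), (3, 4)]
  | .inr (.inl s), .inr (.inr p) => s = 0 ∧ p.2 = 0
  | .inr (.inr p), .inr (.inr q) => p.1 = q.1 ∧ p.2.val + 1 = q.2.val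
  | _, _ => False

instance instDecidableRelGadgetRel {A : Type*} [DecidableEq A] (H : SimpleGraph A)
    [DecidableRel H.Adj] (z : A) (k : ℕ) : DecidableRel (gadgetRel H z k)
  | .inl a, .inl b => inferInstanceAs (Decidable (H.Adj a b))
  | .inl a, .inr (.inl s) => inferInstanceAs (Decidable (a = z ∧ s = 0))
  | .inr (.inl s), .inr (.inl t) => inferInstanceAs
      (Decidable ((s, t) ∈ [((0 : Fin 5), (1 : Fin 5)), (0, 2), (0, 3), (3, 4)]))
  | .inr (.inl s), .inr (.inr p) => inferInstanceAs (Decidable (s = 0 ∧ p.2 = 0))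
  | .inr (.inr p), .inr (.inr q) =>
      inferInstanceAs (Decidable (p.1 = q.1 ∧ p.2.val + 1 = q.2.val))
  | .inl _, .inr (.inr _) => inferInstanceAs (Decidable False)
  | .inr (.inl _), .inl _ => inferInstanceAs (Decidable False)
  | .inr (.inr _), .inl _ => inferInstanceAs (Decidable False)
  | .inr (.inr _), .inr (.inl _) => inferInstanceAs (Decidable False)

/-- The graph obtained from the disjoint union of `H` and `S` by adding the edge `zx` and
identifying an end vertex of each of `k` copies of `P₆` with `x`. -/
def gadgetGraph {A : Type*} (H : SimpleGraph A) (z : A) (k : ℕ) :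
    SimpleGraph (GadgetVertex A k) :=
  SimpleGraph.fromRel (gadgetRel H z k)

instance instDecidableRelGadgetGraph {A : Type*} [DecidableEq A] (H : SimpleGraph A)
    [DecidableRel H.Adj] (z : A) (k : ℕ) : DecidableRel (gadgetGraph H z k).Adj := fun a b =>
  inferInstanceAs (Decidable (a ≠ b ∧ (gadgetRel H z k a b ∨ gadgetRel H z k b a)))

/-- The vertex `v` of `S` inside the graph `gadgetGraph H z k`. -/
abbrev gadgetV (A : Type*) (k : ℕ) : GadgetVertex A k := Sum.inr (Sum.inl 4)

/-- The graphs `Z_k`. -/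
abbrev graphZk (k : ℕ) : SimpleGraph (GadgetVertex (Fin 9) k) := gadgetGraph graphZ 8 k

/-- The graphs `W_k`, built from the cycle `C₆`, with `z` any of its vertices. -/
abbrev graphWk (z : Fin 6) (k : ℕ) : SimpleGraph (GadgetVertex (Fin 6) k) :=
  gadgetGraph (SimpleGraph.cycleGraph 6) z k

/-! The graph splits into k pendant paths and a core of bounded size, and each path contributes
exactly two moves. Once x is dominated, what counts of a pendant path is its tail, the four vertices
not adjacent to x. Only vertices of the path reach the tail, and these now dominate nothing new
outside the path. No single move finishes the tail, every move touching it has an answer that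
finishes it, and after the move at the middle of the five path vertices any further move there
finishes it. So Staller can answer each of Dominator's moves in a tail and get two moves out of it.
Dominator can answer Staller's moves in the same way, and if nothing else is left to play he opens a
tail at the middle. Hence the tails add exactly two moves each, whoever is to move
(`endsWithin_union_biUnion_iff`).

For the lower bound Staller begins at a leaf next to x, which dominates only that leaf and x; the
path vertices next to x are then given away by the continuation principle (`EndsWithin.mono`). For
the upper bound Dominator answers at x and the effect of Staller's first move is ignored, unless it
was made on a path; then that one path is kept together with the core. What remains are finitely
many games on at most 19 bits, independent of k, which are evaluated with bit masks. A common
threshold t for them yields the value 2k + t + 2 (`endsWithin_gadget_iff_of_mask`).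

Deleting v amounts to forbidding v as a move and not requiring it to be dominated, so both graphs
are handled by the same lemmas. The evaluations give t = 5 and t = 3 with the base `graphZ`, and t =
4 and t = 2 with the hexagon: the drop by two is a finite fact that the paths propagate. The two
bases supply the two parities, and the bases with one leaf supply the values 4 and 5. -/

/-! ### Bounds on game length as a recursive predicate -/

/-- In the game whose positions are joined by `step`, the second player (who wants the game to be
short) can ensure that at most `n` further moves are made. The flag says who moves next: `true`
for the player who prolongs the game. -/
def EndsWithin {P : Type*} (step : P → P → Prop) : Bool → ℕ → P → Prop
  | _, 0, p => ∀ q, ¬ step p q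
  | true, n + 1, p => ∀ q, step p q → EndsWithin step false n q
  | false, n + 1, p => (∀ q, ¬ step p q) ∨ ∃ q, step p q ∧ EndsWithin step true n q

theorem endsWithin_of_stuck {P : Type*} {step : P → P → Prop} {p : P} (h : ∀ q, ¬ step p q)
    (b : Bool) (n : ℕ) : EndsWithin step b n p := by
  cases n with
  | zero => exact h
  | succ n =>
    cases b with
    | false => exact Or.inl h
    | true => exact fun q hq => (h q hq).elim

/-- Bisimilar positions have the same value. -/
theorem endsWithin_congr {P Q : Type*} {s : P → P → Prop} {t : Q → Q → Prop} (R : P → Q → Prop)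
    (forth : ∀ p q p', R p q → s p p' → ∃ q', t q q' ∧ R p' q')
    (back : ∀ p q q', R p q → t q q' → ∃ p', s p p' ∧ R p' q')
    (b : Bool) (n : ℕ) {p : P} {q : Q} (h : R p q) :
    EndsWithin s b n p ↔ EndsWithin t b n q := by
  have stuck : ∀ p q, R p q → ((∀ p', ¬ s p p') ↔ ∀ q', ¬ t q q') := fun p q h =>
    ⟨fun hp q' hq => by obtain ⟨p', hp', -⟩ := back p q q' h hq; exact hp p' hp',
      fun hq p' hp => by obtain ⟨q', hq', -⟩ := forth p q p' h hp; exact hq q' hq'⟩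
  induction n generalizing b p q with
  | zero => cases b <;> exact stuck p q h
  | succ n ih =>
    cases b with
    | true =>
      constructor
      · intro H q' hq'
        obtain ⟨p', hp', h'⟩ := back p q q' h hq'
        exact (ih false h').1 (H p' hp')
      · intro H p' hp'
        obtain ⟨q', hq', h'⟩ := forth p q p' h hp'
        exact (ih false h').2 (H q' hq')
    | false =>
      refine or_congr (stuck p q h) ⟨?_, ?_⟩
      · rintro ⟨p', hp', H⟩
        obtain ⟨q', hq', h'⟩ := forth p q p' h hp'
        exact ⟨q', hq', (ih true h').1 H⟩
      · rintro ⟨q', hq', H⟩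
        obtain ⟨p', hp', h'⟩ := back p q q' h hq'
        exact ⟨p', hp', (ih true h').2 H⟩

/-! ### Continuation principle and two-move blocks -/

/-- One move of the domination game in which the vertices of `M` may be chosen, `u` dominates
`N u`, and the positions are the sets of vertices that remain to be dominated. -/
def DomStep {V : Type*} [DecidableEq V] (N : V → Finset V) (M : Finset V)
    (U U' : Finset V) : Prop :=
  ∃ u ∈ M, ¬ Disjoint (N u) U ∧ U' = U \ N u

section DomStep

variable {V : Type*} [DecidableEq V] {N : V → Finset V} {M : Finset V}

theorem domStep_sdiff {U : Finset V} {u : V} (hu : u ∈ M) (h : ¬ Disjoint (N u) U) :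
    DomStep N M U (U \ N u) :=
  ⟨u, hu, h, rfl⟩

/-- The continuation principle. -/
theorem EndsWithin.mono {b : Bool} {n : ℕ} {U U' : Finset V} (hU : U ⊆ U')
    (h : EndsWithin (DomStep N M) b n U') : EndsWithin (DomStep N M) b n U := by
  have stuck : ∀ {U U' : Finset V}, U ⊆ U' → (∀ W, ¬ DomStep N M U' W) →
      ∀ W, ¬ DomStep N M U W := by
    rintro U U' hU h W ⟨u, hu, hd, -⟩
    exact h _ (domStep_sdiff hu fun hd' => hd (hd'.mono_right hU))
  induction n generalizing b U U' with
  | zero => cases b <;> exact stuck hU h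
  | succ n ih =>
    cases b with
    | true =>
      rintro W ⟨u, hu, hd, rfl⟩
      exact ih (Finset.sdiff_subset_sdiff hU subset_rfl)
        (h _ (domStep_sdiff hu fun hd' => hd (hd'.mono_right hU)))
    | false =>
      rcases h with h | ⟨W', ⟨u, hu, -, rfl⟩, h⟩
      · exact Or.inl (stuck hU h)
      · by_cases hs : ∀ W, ¬ DomStep N M U W
        · exact Or.inl hs
        · push Not at hs
          -- If the move good for `U'` is illegal in `U`, then `N u` misses `U`, so any legal move
          -- leaves a subset of `U' \ N u`.
          by_cases hd : Disjoint (N u) U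
          · obtain ⟨W, u', hu', hd', rfl⟩ := hs
            refine Or.inr ⟨_, domStep_sdiff hu' hd', ih ?_ h⟩
            intro w hw
            have hwU := (Finset.mem_sdiff.1 hw).1
            exact Finset.mem_sdiff.2 ⟨hU hwU, fun hN => Finset.disjoint_left.1 hd hN hwU⟩
          · exact Or.inr ⟨_, domStep_sdiff hu hd, ih (Finset.sdiff_subset_sdiff hU subset_rfl) h⟩

theorem EndsWithin.false_succ {n : ℕ} {U : Finset V} (h : EndsWithin (DomStep N M) true n U) :
    EndsWithin (DomStep N M) false (n + 1) U := by
  by_cases hs : ∀ W, ¬ DomStep N M U W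
  · exact Or.inl hs
  · push Not at hs
    obtain ⟨W, u, hu, hd, rfl⟩ := hs
    exact Or.inr ⟨_, domStep_sdiff hu hd, h.mono Finset.sdiff_subset⟩

/-- An intended reply need not be legal: if it dominates nothing new, any legal move does at least
as well by the continuation principle. This spares legality checks in every strategy for Dominator
below. -/
theorem EndsWithin.false_of_reply {n : ℕ} {U : Finset V} {u : V} (hu : u ∈ M)
    (h : EndsWithin (DomStep N M) true n (U \ N u)) :
    EndsWithin (DomStep N M) false (n + 1) U := by
  by_cases hd : Disjoint (N u) U
  · rw [Finset.sdiff_eq_self_of_disjoint hd.symm] at h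
    exact h.false_succ
  · exact Or.inr ⟨_, domStep_sdiff hu hd, h⟩

/-- A set `A` of undominated vertices on which the first player can force, and the second player
can hold the game to, exactly two moves: every move leaves a legal answer in `A`, which finishes `A`
if the move was in `A`; and some move in `A` can only be followed in `A` by a move that
finishes `A`. -/
structure IsTwoMoveBlock (N : V → Finset V) (M A : Finset V) : Prop where
  answer : ∀ u ∈ M, ∃ u' ∈ M, ¬ Disjoint (N u') (A \ N u) ∧
    (¬ Disjoint (N u) A → A ⊆ N u ∪ N u')
  opening : ∃ u ∈ M, ¬ Disjoint (N u) A ∧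
    ∀ u' ∈ M, ¬ Disjoint (N u') (A \ N u) → A ⊆ N u ∪ N u'

theorem union_sdiff_of_disjoint {A B X : Finset V} (h : Disjoint X B) :
    (B ∪ A) \ X = B ∪ A \ X := by
  rw [Finset.union_sdiff_distrib, Finset.sdiff_eq_self_of_disjoint h.symm]

theorem union_sdiff_of_disjoint' {A B X : Finset V} (h : Disjoint X A) :
    (B ∪ A) \ X = B \ X ∪ A := by
  rw [Finset.union_sdiff_distrib, Finset.sdiff_eq_self_of_disjoint h.symm]

theorem union_sdiff_sdiff_eq {A B X Y : Finset V} (hX : Disjoint X B) (hY : Disjoint Y B)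
    (h : A ⊆ X ∪ Y) : ((B ∪ A) \ X) \ Y = B := by
  rw [union_sdiff_of_disjoint hX, union_sdiff_of_disjoint hY, sdiff_sdiff_left]
  rw [Finset.sdiff_eq_empty_iff_subset.2 (by simpa using h), Finset.union_empty]

theorem IsTwoMoveBlock.not_endsWithin_one {A B : Finset V} (hA : IsTwoMoveBlock N M A) (b : Bool) :
    ¬ EndsWithin (DomStep N M) b 1 (B ∪ A) := by
  have key : ∀ u ∈ M, ∃ W, DomStep N M ((B ∪ A) \ N u) W := by
    intro u hu
    obtain ⟨u', hu', hd, -⟩ := hA.answer u hu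
    refine ⟨_, domStep_sdiff hu' fun h => hd (h.mono_right ?_)⟩
    exact Finset.sdiff_subset_sdiff Finset.subset_union_right subset_rfl
  obtain ⟨u₀, hu₀, hd₀, -⟩ := hA.opening
  have hd₀' : ¬ Disjoint (N u₀) (B ∪ A) := fun h => hd₀ (h.mono_right Finset.subset_union_right)
  intro h
  cases b with
  | true =>
    obtain ⟨W, hW⟩ := key u₀ hu₀
    exact h _ (domStep_sdiff hu₀ hd₀') _ hW
  | false =>
    rcases h with h | ⟨W, ⟨u, hu, -, rfl⟩, h⟩
    · exact h _ (domStep_sdiff hu₀ hd₀')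
    · obtain ⟨W, hW⟩ := key u hu
      exact h _ hW

/-- Dominator's strategy: answer a move in `A` by finishing `A`, and otherwise follow the strategy
for `B`. Only when `B` is exhausted and he is to move must he enter `A` himself; the opening then
forces Staller to finish it. -/
theorem IsTwoMoveBlock.endsWithin_add_two {A B : Finset V} (hA : IsTwoMoveBlock N M A)
    (hsep : ∀ u ∈ M, Disjoint (N u) A ∨ Disjoint (N u) B) {b : Bool} {n : ℕ}
    (h : EndsWithin (DomStep N M) b n B) : EndsWithin (DomStep N M) b (n + 2) (B ∪ A) := by
  induction n using Nat.strong_induction_on generalizing b B with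
  | _ n ih =>
  cases b with
  | true =>
    rintro W ⟨u, hu, hd, rfl⟩
    by_cases hdA : Disjoint (N u) A
    · have hdB : ¬ Disjoint (N u) B := fun h => hd (Finset.disjoint_union_right.2 ⟨h, hdA⟩)
      cases n with
      | zero => exact (h _ (domStep_sdiff hu hdB)).elim
      | succ n =>
        rw [union_sdiff_of_disjoint' hdA]
        exact ih n n.lt_succ_self
          (fun w hw => (hsep w hw).imp_right fun h => h.mono_right Finset.sdiff_subset)
          (h _ (domStep_sdiff hu hdB))
    · have hdB := (hsep u hu).resolve_left hdA
      obtain ⟨u', hu', hd', hfin⟩ := hA.answer u hu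
      have hdB' : Disjoint (N u') B :=
        (hsep u' hu').resolve_left fun h => hd' (h.mono_right Finset.sdiff_subset)
      refine EndsWithin.false_of_reply hu' ?_
      rwa [union_sdiff_sdiff_eq hdB hdB' (hfin hdA)]
  | false =>
    have stuckCase : (∀ W, ¬ DomStep N M B W) →
        EndsWithin (DomStep N M) false (n + 2) (B ∪ A) := by
      intro hs
      have hBdisj : ∀ u ∈ M, Disjoint (N u) B := fun u hu => by
        by_contra hd
        exact hs _ (domStep_sdiff hu hd)
      obtain ⟨u, hu, -, hfin⟩ := hA.opening
      refine EndsWithin.false_of_reply hu ?_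
      rintro W ⟨u', hu', hd', rfl⟩
      rw [union_sdiff_of_disjoint (hBdisj u hu), Finset.disjoint_union_right] at hd'
      rw [union_sdiff_sdiff_eq (hBdisj u hu) (hBdisj u' hu')
        (hfin u' hu' fun hd => hd' ⟨hBdisj u' hu', hd⟩)]
      exact endsWithin_of_stuck hs false n
    cases n with
    | zero => exact stuckCase h
    | succ n =>
      rcases h with h | ⟨W, ⟨u, hu, hd, rfl⟩, h⟩
      · exact stuckCase h
      · have hdA := (hsep u hu).resolve_right hd
        refine EndsWithin.false_of_reply hu ?_
        rw [union_sdiff_of_disjoint' hdA]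
        exact ih n n.lt_succ_self
          (fun w hw => (hsep w hw).imp_right fun h => h.mono_right Finset.sdiff_subset) h

/-- Staller's strategy: play in `B` as if `A` were absent, and answer in `A` when Dominator moves
there. The pair of moves leaves all of `B`, and continuation discards any rest of `A`. -/
theorem IsTwoMoveBlock.endsWithin_of_add_two {A B : Finset V} (hA : IsTwoMoveBlock N M A)
    (hsep : ∀ u ∈ M, Disjoint (N u) A ∨ Disjoint (N u) B) {b : Bool} {n : ℕ}
    (h : EndsWithin (DomStep N M) b (n + 2) (B ∪ A)) : EndsWithin (DomStep N M) b n B := by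
  induction n generalizing b B with
  | zero =>
    have hstuck : ∀ W, ¬ DomStep N M B W := by
      cases b with
      | true =>
        rintro W ⟨u, hu, hd, rfl⟩
        have hdA := (hsep u hu).resolve_right hd
        have := h _ (domStep_sdiff hu fun hd' => hd (hd'.mono_right Finset.subset_union_left))
        rw [union_sdiff_of_disjoint' hdA] at this
        exact hA.not_endsWithin_one _ this
      | false =>
        rcases h with h | ⟨W, ⟨u, hu, hd, rfl⟩, h⟩
        · rintro W ⟨u, hu, hd, rfl⟩
          exact h _ (domStep_sdiff hu fun hd' => hd (hd'.mono_right Finset.subset_union_left))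
        · by_cases hdA : Disjoint (N u) A
          · rw [union_sdiff_of_disjoint' hdA] at h
            exact (hA.not_endsWithin_one _ h).elim
          · have hdB := (hsep u hu).resolve_left hdA
            obtain ⟨u', hu', hd', -⟩ := hA.answer u hu
            rw [union_sdiff_of_disjoint hdB] at h
            have h' := h _ (domStep_sdiff hu' fun h =>
              hd' (h.mono_right Finset.subset_union_right))
            refine EndsWithin.mono ?_ h'
            rw [union_sdiff_of_disjoint
              ((hsep u' hu').resolve_left fun h => hd' (h.mono_right Finset.sdiff_subset))]
            exact Finset.subset_union_left
    exact endsWithin_of_stuck hstuck b 0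
  | succ n ih =>
    have hsep' : ∀ u, ∀ w ∈ M, Disjoint (N w) A ∨ Disjoint (N w) (B \ N u) :=
      fun u w hw => (hsep w hw).imp_right fun h => h.mono_right Finset.sdiff_subset
    cases b with
    | true =>
      rintro W ⟨u, hu, hd, rfl⟩
      have := h _ (domStep_sdiff hu fun hd' => hd (hd'.mono_right Finset.subset_union_left))
      rw [union_sdiff_of_disjoint' ((hsep u hu).resolve_right hd)] at this
      exact ih (hsep' u) this
    | false =>
      rcases h with h | ⟨W, ⟨u, hu, hd, rfl⟩, h⟩
      · refine endsWithin_of_stuck ?_ _ _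
        rintro W ⟨u, hu, hd, rfl⟩
        exact h _ (domStep_sdiff hu fun hd' => hd (hd'.mono_right Finset.subset_union_left))
      · by_cases hdA : Disjoint (N u) A
        · rw [union_sdiff_of_disjoint' hdA] at h
          exact EndsWithin.false_of_reply hu (ih (hsep' u) h)
        · obtain ⟨u', hu', hd', -⟩ := hA.answer u hu
          rw [union_sdiff_of_disjoint ((hsep u hu).resolve_left hdA)] at h
          have h' := h _ (domStep_sdiff hu' fun h =>
            hd' (h.mono_right Finset.subset_union_right))
          refine EndsWithin.mono ?_ h'
          rw [union_sdiff_of_disjoint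
            ((hsep u' hu').resolve_left fun h => hd' (h.mono_right Finset.sdiff_subset))]
          exact Finset.subset_union_left

/-- Pairwise independent two-move blocks contribute two moves each. -/
theorem endsWithin_union_biUnion_iff {ι : Type*} [DecidableEq ι] {A : ι → Finset V} {B : Finset V}
    (J : Finset ι) (hA : ∀ j ∈ J, IsTwoMoveBlock N M (A j))
    (hAA : ∀ i ∈ J, ∀ j ∈ J, i ≠ j → ∀ u ∈ M, Disjoint (N u) (A i) ∨ Disjoint (N u) (A j))
    (hAB : ∀ j ∈ J, ∀ u ∈ M, Disjoint (N u) (A j) ∨ Disjoint (N u) B) (b : Bool) (n : ℕ) :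
    EndsWithin (DomStep N M) b (n + 2 * J.card) (B ∪ J.biUnion A) ↔
      EndsWithin (DomStep N M) b n B := by
  induction J using Finset.induction_on with
  | empty => simp
  | insert j J hj ih =>
    have hset : B ∪ (insert j J).biUnion A = (B ∪ J.biUnion A) ∪ A j := by
      rw [Finset.biUnion_insert, Finset.union_comm (A j), Finset.union_assoc]
    have hsep : ∀ u ∈ M, Disjoint (N u) (A j) ∨ Disjoint (N u) (B ∪ J.biUnion A) := by
      intro u hu
      by_cases hd : Disjoint (N u) (A j)
      · exact Or.inl hd
      · refine Or.inr (Finset.disjoint_union_right.2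
          ⟨(hAB j (Finset.mem_insert_self _ _) u hu).resolve_left hd, ?_⟩)
        refine (Finset.disjoint_biUnion_right _ _ _).2 fun i hi => ?_
        refine (hAA j (Finset.mem_insert_self _ _) i (Finset.mem_insert_of_mem hi) ?_ u
          hu).resolve_left hd
        rintro rfl
        exact hj hi
    have hj' := hA j (Finset.mem_insert_self _ _)
    rw [hset, Finset.card_insert_of_notMem hj, mul_add, mul_one, ← add_assoc,
      ← ih (fun i hi => hA i (Finset.mem_insert_of_mem hi))
        (fun i hi i' hi' => hAA i (Finset.mem_insert_of_mem hi) i' (Finset.mem_insert_of_mem hi'))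
        (fun i hi => hAB i (Finset.mem_insert_of_mem hi))]
    exact ⟨hj'.endsWithin_of_add_two hsep, hj'.endsWithin_add_two hsep⟩

end DomStep

/-! ### Evaluation by bit masks -/

/-- The game with bit masks: `d` marks the vertices that remain to be dominated, and `ms` lists
what the moves dominate. -/
def endsWithinMask (ms : List ℕ) : Bool → ℕ → ℕ → Bool
  | _, 0, d => ms.all fun m => Nat.beq (Nat.land d m) 0
  | true, n + 1, d => ms.all fun m =>
      Nat.beq (Nat.land d m) 0 || endsWithinMask ms false n (Nat.xor d (Nat.land d m))
  | false, n + 1, d => (ms.all fun m => Nat.beq (Nat.land d m) 0) || ms.any fun m =>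
      !Nat.beq (Nat.land d m) 0 && endsWithinMask ms true n (Nat.xor d (Nat.land d m))

/-- One move of the game with bit masks. -/
def MaskStep (ms : List ℕ) (d d' : ℕ) : Prop :=
  ∃ m ∈ ms, d &&& m ≠ 0 ∧ d' = d ^^^ (d &&& m)

/-- Here `d ^^^ (d &&& m)` is the set difference of `d` and `m`. The evaluator is built from
`Nat.land`, `Nat.xor` and `Nat.beq`, which the kernel computes directly on numerals. -/
theorem endsWithinMask_iff (ms : List ℕ) (b : Bool) (n d : ℕ) :
    endsWithinMask ms b n d = true ↔ EndsWithin (MaskStep ms) b n d := by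
  have illegal : ∀ d m, Nat.beq (Nat.land d m) 0 = true ↔ d &&& m = 0 := fun d m =>
    ⟨Nat.eq_of_beq_eq_true, fun h => by rw [show Nat.land d m = 0 from h]; rfl⟩
  have stuck : ∀ d, (ms.all fun m => Nat.beq (Nat.land d m) 0) = true ↔
      ∀ d', ¬ MaskStep ms d d' := by
    intro d
    simp only [List.all_eq_true, illegal, MaskStep]
    constructor
    · rintro h d' ⟨m, hm, hd, -⟩
      exact hd (h m hm)
    · intro h m hm
      by_contra hd
      exact h _ ⟨m, hm, hd, rfl⟩
  induction n generalizing b d with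
  | zero => cases b <;> exact stuck d
  | succ n ih =>
    cases b with
    | true =>
      simp only [endsWithinMask, EndsWithin, List.all_eq_true, Bool.or_eq_true, ih, illegal]
      constructor
      · rintro h d' ⟨m, hm, hd, rfl⟩
        exact (h m hm).resolve_left hd
      · intro h m hm
        by_cases hd : d &&& m = 0
        · exact Or.inl hd
        · exact Or.inr (h _ ⟨m, hm, hd, rfl⟩)
    | false =>
      rw [endsWithinMask, EndsWithin, Bool.or_eq_true, stuck]
      refine or_congr Iff.rfl ?_
      simp only [List.any_eq_true, Bool.and_eq_true, ih, Bool.not_eq_true', ← Bool.not_eq_true,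
        illegal]
      constructor
      · rintro ⟨m, hm, hd, h⟩
        exact ⟨_, ⟨m, hm, hd, rfl⟩, h⟩
      · rintro ⟨d', ⟨m, hm, hd, rfl⟩, h⟩
        exact ⟨m, hm, hd, h⟩

/-- A position of the domination game can be evaluated with bit masks, where `c` gives the bit
that stands for a vertex. -/
theorem endsWithin_iff_mask {V : Type*} [DecidableEq V] {N : V → Finset V} {M U : Finset V}
    (c : V → ℕ) {ms : List ℕ} {d : ℕ}
    (hms : ∀ u ∈ M, Disjoint (N u) U ∨ ∃ m ∈ ms, ∀ w ∈ U, (m.testBit (c w) = true ↔ w ∈ N u))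
    (hM : ∀ m ∈ ms, ∃ u ∈ M, ∀ w ∈ U, (m.testBit (c w) = true ↔ w ∈ N u))
    (hU : ∀ w ∈ U, d.testBit (c w) = true)
    (hd : ∀ i, d.testBit i = true → ∃ w ∈ U, c w = i) (b : Bool) (n : ℕ) :
    EndsWithin (DomStep N M) b n U ↔ endsWithinMask ms b n d = true := by
  rw [endsWithinMask_iff]
  -- Every reachable position is a subset of the initial `U`, so masks need to be right only on `U`.
  -- Moreover `c` need not be injective, as long as the masks agree with the neighbourhoods on all
  -- of `U`.
  let R : Finset V → ℕ → Prop := fun W e => W ⊆ U ∧ (∀ w ∈ U, w ∈ W ↔ e.testBit (c w) = true) ∧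
    ∀ i, e.testBit i = true → ∃ w ∈ U, c w = i
  have hR : ∀ W e u m, R W e → (∀ w ∈ U, (m.testBit (c w) = true ↔ w ∈ N u)) →
      (¬ Disjoint (N u) W ↔ e &&& m ≠ 0) ∧ R (W \ N u) (e ^^^ (e &&& m)) := by
    rintro W e u m ⟨hWU, hWe, he⟩ hum
    refine ⟨?_, Finset.sdiff_subset.trans hWU, fun w hw => ?_, fun i hi => he i ?_⟩
    · rw [not_iff_comm, not_not, Finset.disjoint_left]
      constructor
      · intro h w hwN hwW
        have hw := hWU hwW
        have := congrArg (fun x => Nat.testBit x (c w)) h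
        simp [Nat.testBit_and, (hWe w hw).1 hwW, (hum w hw).2 hwN] at this
      · intro h
        refine Nat.eq_of_testBit_eq fun i => ?_
        rw [Nat.zero_testBit, Nat.testBit_and, Bool.and_eq_false_iff]
        by_contra! hi
        obtain ⟨w, hw, rfl⟩ := he i (by simpa using hi.1)
        exact h ((hum w hw).1 (by simpa using hi.2)) ((hWe w hw).2 (by simpa using hi.1))
    · rw [Finset.mem_sdiff, hWe w hw, ← hum w hw]
      cases h1 : e.testBit (c w) <;> cases h2 : m.testBit (c w) <;>
        simp [Nat.testBit_xor, Nat.testBit_and, h1, h2]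
    · rw [Nat.testBit_xor, Nat.testBit_and] at hi
      cases h1 : e.testBit i <;> simp [h1] at hi ⊢
  refine endsWithin_congr R ?_ ?_ b n ⟨subset_rfl, fun w hw => by simp [hw, hU w hw], hd⟩
  · rintro W e W' hWe ⟨u, hu, hdis, rfl⟩
    rcases hms u hu with h | ⟨m, hm, hum⟩
    · exact (hdis (h.mono_right hWe.1)).elim
    · obtain ⟨h1, h2⟩ := hR W e u m hWe hum
      exact ⟨_, ⟨m, hm, h1.1 hdis, rfl⟩, h2⟩
  · rintro W e e' hWe ⟨m, hm, hne, rfl⟩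
    obtain ⟨u, hu, hum⟩ := hM m hm
    obtain ⟨h1, h2⟩ := hR W e u m hWe hum
    exact ⟨_, ⟨u, hu, h1.2 hne, rfl⟩, h2⟩

/-! ### The game length and vertex deletion in terms of `EndsWithin` -/

theorem mem_closedNbhd {V : Type*} [Fintype V] [DecidableEq V] {G : SimpleGraph V}
    [DecidableRel G.Adj] {u w : V} : w ∈ closedNbhd G u ↔ w = u ∨ G.Adj u w := by
  simp [closedNbhd]

theorem mem_legalMoves {V : Type*} [Fintype V] [DecidableEq V] {G : SimpleGraph V}
    [DecidableRel G.Adj] {D : Finset V} {u : V} :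
    u ∈ legalMoves G D ↔ ¬ Disjoint (closedNbhd G u) Dᶜ := by
  simp [legalMoves, disjoint_compl_right_iff]

/-- A supremum is bounded when all its terms are, an infimum when some term is; this matches the
quantifiers in `EndsWithin`. Positions are complemented: dominated sets become sets still to be
dominated. -/
theorem gameLength_le_iff {V : Type*} [Fintype V] [DecidableEq V] (G : SimpleGraph V)
    [DecidableRel G.Adj] (b : Bool) (n : ℕ) (D : Finset V) :
    gameLength G b D ≤ n ↔
      EndsWithin (DomStep (closedNbhd G) Finset.univ) b n Dᶜ := by
  have stuck : ∀ D : Finset V, ¬ (legalMoves G D).Nonempty ↔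
      ∀ W, ¬ DomStep (closedNbhd G) Finset.univ Dᶜ W := by
    intro D
    rw [Finset.not_nonempty_iff_eq_empty, Finset.eq_empty_iff_forall_notMem]
    simp only [mem_legalMoves]
    constructor
    · rintro h W ⟨u, -, hd, -⟩
      exact h u hd
    · exact fun h u hd => h _ (domStep_sdiff (Finset.mem_univ u) hd)
  have hcompl : ∀ (D : Finset V) (u : V), (D ∪ closedNbhd G u)ᶜ = Dᶜ \ closedNbhd G u := by
    intro D u
    rw [Finset.compl_union, Finset.sdiff_eq_inter_compl]
  induction n generalizing b D with
  | zero =>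
    have hz : EndsWithin (DomStep (closedNbhd G) Finset.univ) b 0 Dᶜ ↔
        ∀ W, ¬ DomStep (closedNbhd G) Finset.univ Dᶜ W := by cases b <;> rfl
    rw [hz, ← stuck, gameLength]
    split_ifs with h <;> simp [h]
  | succ n ih =>
    by_cases h : (legalMoves G D).Nonempty
    · cases b with
      | true =>
        rw [gameLength, dif_pos h, if_pos rfl, add_comm, Nat.succ_le_succ_iff, Finset.sup'_le_iff]
        simp only [ih, hcompl]
        constructor
        · rintro H W ⟨u, -, hd, rfl⟩
          exact H ⟨u, mem_legalMoves.2 hd⟩ (Finset.mem_attach _ _)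
        · rintro H ⟨u, hu⟩ -
          exact H _ (domStep_sdiff (Finset.mem_univ u) (mem_legalMoves.1 hu))
      | false =>
        rw [gameLength, dif_pos h, if_neg Bool.false_ne_true, add_comm, Nat.succ_le_succ_iff,
          Finset.inf'_le_iff]
        simp only [ih, hcompl]
        constructor
        · rintro ⟨⟨u, hu⟩, -, H⟩
          exact Or.inr ⟨_, domStep_sdiff (Finset.mem_univ u) (mem_legalMoves.1 hu), H⟩
        · rintro (H | ⟨W, ⟨u, -, hd, rfl⟩, H⟩)
          · exact absurd h ((stuck D).2 H)
          · exact ⟨⟨u, mem_legalMoves.2 hd⟩, Finset.mem_attach _ _, H⟩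
    · rw [gameLength, dif_neg h]
      exact iff_of_true (Nat.zero_le _) (endsWithin_of_stuck ((stuck D).1 h) _ _)

theorem stallerStartGameDomNumber_le_iff {V : Type*} [Fintype V] [DecidableEq V]
    (G : SimpleGraph V) [DecidableRel G.Adj] (n : ℕ) :
    stallerStartGameDomNumber G ≤ n ↔
      EndsWithin (DomStep (closedNbhd G) Finset.univ) true n Finset.univ := by
  rw [stallerStartGameDomNumber, gameLength_le_iff, Finset.compl_empty]

/-- The game on `G - v` is the game on `G` in which `v` may not be chosen and need not be
dominated. -/
theorem stallerStartGameDomNumber_removeVertex_le_iff {V : Type*} [Fintype V] [DecidableEq V]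
    (G : SimpleGraph V) [DecidableRel G.Adj] (v : V) (n : ℕ) :
    stallerStartGameDomNumber (removeVertex G v) ≤ n ↔
      EndsWithin (DomStep (closedNbhd G) {v}ᶜ) true n {v}ᶜ := by
  rw [stallerStartGameDomNumber_le_iff]
  have hN : ∀ u w : {w : V // w ≠ v},
      w ∈ closedNbhd (removeVertex G v) u ↔ w.1 ∈ closedNbhd G u.1 := by
    intro u w
    simp [mem_closedNbhd, Subtype.ext_iff]
  let R : Finset {w : V // w ≠ v} → Finset V → Prop := fun W W' => v ∉ W' ∧ ∀ w, w ∈ W ↔ w.1 ∈ W'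
  have hR : ∀ W W' u, R W W' →
      (Disjoint (closedNbhd (removeVertex G v) u) W ↔ Disjoint (closedNbhd G u.1) W') ∧
      R (W \ closedNbhd (removeVertex G v) u) (W' \ closedNbhd G u.1) := by
    rintro W W' u ⟨hv, hW⟩
    refine ⟨?_, fun h => hv (Finset.mem_sdiff.1 h).1, fun w => ?_⟩
    · simp only [Finset.disjoint_left]
      constructor
      · intro h w hw hw'
        have hwv : w ≠ v := by
          rintro rfl
          exact hv hw'
        exact h (a := ⟨w, hwv⟩) ((hN _ _).2 hw) ((hW _).2 hw')
      · exact fun h w hw hw' => h ((hN _ _).1 hw) ((hW _).1 hw')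
    · rw [Finset.mem_sdiff, Finset.mem_sdiff, hN, hW]
  refine endsWithin_congr R ?_ ?_ true n ⟨by simp, fun w => by simp [w.2]⟩
  · rintro W W' W₁ h ⟨u, -, hd, rfl⟩
    obtain ⟨h1, h2⟩ := hR W W' u h
    exact ⟨_, ⟨u.1, by simp [u.2], fun hd' => hd (h1.2 hd'), rfl⟩, h2⟩
  · rintro W W' W₁ h ⟨u, hu, hd, rfl⟩
    obtain ⟨h1, h2⟩ := hR W W' ⟨u, by simpa using hu⟩ h
    exact ⟨_, ⟨_, Finset.mem_univ _, fun hd' => hd (h1.1 hd'), rfl⟩, h2⟩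

/-! ### Neighbourhoods in gadget graphs and the pendant paths -/

/-- Distance at most one in a path on five vertices. -/
def pathNear (i j : Fin 5) : Prop := j = i ∨ i.val + 1 = j.val ∨ j.val + 1 = i.val

instance instDecidableRelPathNear : DecidableRel pathNear := fun i j =>
  inferInstanceAs (Decidable (j = i ∨ i.val + 1 = j.val ∨ j.val + 1 = i.val))

/-- Distance at most one in the graph `S`. -/
def starNear (s t : Fin 5) : Prop :=
  t = s ∨ (s, t) ∈ [((0 : Fin 5), (1 : Fin 5)), (0, 2), (0, 3), (3, 4)] ∨
    (t, s) ∈ [((0 : Fin 5), (1 : Fin 5)), (0, 2), (0, 3), (3, 4)]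

instance instDecidableRelStarNear : DecidableRel starNear := fun s t =>
  inferInstanceAs (Decidable (t = s ∨
    (s, t) ∈ [((0 : Fin 5), (1 : Fin 5)), (0, 2), (0, 3), (3, 4)] ∨
    (t, s) ∈ [((0 : Fin 5), (1 : Fin 5)), (0, 2), (0, 3), (3, 4)]))

section Gadget

variable {A : Type*} [Fintype A] [DecidableEq A] (H : SimpleGraph A) [DecidableRel H.Adj] (z : A)
  (k : ℕ)

theorem mem_gadget_nbhd (u w : GadgetVertex A k) :
    w ∈ closedNbhd (gadgetGraph H z k) u ↔ w = u ∨ gadgetRel H z k u w ∨ gadgetRel H z k w u := by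
  rw [mem_closedNbhd, gadgetGraph, SimpleGraph.fromRel_adj]
  by_cases h : w = u
  · simp [h]
  · simp [h, Ne.symm h]

theorem inl_mem_nbhd_inl (a b : A) :
    Sum.inl b ∈ closedNbhd (gadgetGraph H z k) (Sum.inl a) ↔ b = a ∨ H.Adj a b := by
  simp only [mem_gadget_nbhd, gadgetRel, Sum.inl.injEq, H.adj_comm b a, or_self]

theorem star_mem_nbhd_inl (a : A) (s : Fin 5) :
    Sum.inr (Sum.inl s) ∈ closedNbhd (gadgetGraph H z k) (Sum.inl a) ↔ a = z ∧ s = 0 := by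
  simp [mem_gadget_nbhd, gadgetRel]

theorem path_mem_nbhd_inl (a : A) (p : Fin k × Fin 5) :
    Sum.inr (Sum.inr p) ∉ closedNbhd (gadgetGraph H z k) (Sum.inl a) := by
  simp [mem_gadget_nbhd, gadgetRel]

theorem inl_mem_nbhd_star (a : A) (s : Fin 5) :
    Sum.inl a ∈ closedNbhd (gadgetGraph H z k) (Sum.inr (Sum.inl s)) ↔ a = z ∧ s = 0 := by
  simp [mem_gadget_nbhd, gadgetRel]

theorem star_mem_nbhd_star (s t : Fin 5) :
    Sum.inr (Sum.inl t) ∈ closedNbhd (gadgetGraph H z k) (Sum.inr (Sum.inl s)) ↔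
      starNear s t := by
  simp only [mem_gadget_nbhd, gadgetRel, Sum.inl.injEq, Sum.inr.injEq, starNear]

theorem path_mem_nbhd_star (s : Fin 5) (p : Fin k × Fin 5) :
    Sum.inr (Sum.inr p) ∈ closedNbhd (gadgetGraph H z k) (Sum.inr (Sum.inl s)) ↔
      s = 0 ∧ p.2 = 0 := by
  simp [mem_gadget_nbhd, gadgetRel]

theorem inl_mem_nbhd_path (a : A) (p : Fin k × Fin 5) :
    Sum.inl a ∉ closedNbhd (gadgetGraph H z k) (Sum.inr (Sum.inr p)) := by
  simp [mem_gadget_nbhd, gadgetRel]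

theorem star_mem_nbhd_path (s : Fin 5) (p : Fin k × Fin 5) :
    Sum.inr (Sum.inl s) ∈ closedNbhd (gadgetGraph H z k) (Sum.inr (Sum.inr p)) ↔
      s = 0 ∧ p.2 = 0 := by
  simp [mem_gadget_nbhd, gadgetRel]

theorem path_mem_nbhd_path (p q : Fin k × Fin 5) :
    Sum.inr (Sum.inr q) ∈ closedNbhd (gadgetGraph H z k) (Sum.inr (Sum.inr p)) ↔
      q.1 = p.1 ∧ pathNear p.2 q.2 := by
  simp only [mem_gadget_nbhd, gadgetRel, Sum.inr.injEq, pathNear]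
  by_cases h : q = p
  · simp [h]
  · have h' : ¬ (q.1 = p.1 ∧ q.2 = p.2) := fun hh => h (Prod.ext hh.1 hh.2)
    simp only [h, eq_comm (a := p.1)]
    tauto

end Gadget

section Gadget

variable {A : Type*} {k : ℕ}

/-- The set of vertices of a gadget graph with the given parts. -/
def gadgetSet (B : Finset A) (S : Finset (Fin 5)) (P : Finset (Fin k × Fin 5)) :
    Finset (GadgetVertex A k) :=
  B.disjSum (S.disjSum P)

@[simp]
theorem inl_mem_gadgetSet {B : Finset A} {S : Finset (Fin 5)} {P : Finset (Fin k × Fin 5)}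
    {a : A} : Sum.inl a ∈ gadgetSet B S P ↔ a ∈ B := by
  simp [gadgetSet]

@[simp]
theorem star_mem_gadgetSet {B : Finset A} {S : Finset (Fin 5)} {P : Finset (Fin k × Fin 5)}
    {s : Fin 5} : Sum.inr (Sum.inl s) ∈ gadgetSet B S P ↔ s ∈ S := by
  simp [gadgetSet]

@[simp]
theorem path_mem_gadgetSet {B : Finset A} {S : Finset (Fin 5)} {P : Finset (Fin k × Fin 5)}
    {p : Fin k × Fin 5} : Sum.inr (Sum.inr p) ∈ gadgetSet B S P ↔ p ∈ P := by
  simp [gadgetSet]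

/-- The vertices of a pendant path that are not dominated by `x`. -/
def pathTail (A : Type*) (j : Fin k) : Finset (GadgetVertex A k) :=
  gadgetSet ∅ ∅ ({j} ×ˢ {0}ᶜ)

theorem inl_notMem_pathTail {j : Fin k} {a : A} : Sum.inl a ∉ pathTail A j := by
  simp [pathTail]

theorem star_notMem_pathTail {j : Fin k} {s : Fin 5} :
    Sum.inr (Sum.inl s) ∉ pathTail A j := by
  simp [pathTail]

theorem path_mem_pathTail {j : Fin k} {p : Fin k × Fin 5} :
    Sum.inr (Sum.inr p) ∈ pathTail A j ↔ p.1 = j ∧ p.2 ≠ 0 := by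
  rw [pathTail, path_mem_gadgetSet, Finset.mem_product, Finset.mem_singleton, Finset.mem_compl,
    Finset.mem_singleton]

variable [Fintype A] [DecidableEq A] {H : SimpleGraph A} [DecidableRel H.Adj] {z : A}

theorem disjoint_nbhd_pathTail (j : Fin k) (u : GadgetVertex A k)
    (hu : ∀ i, u ≠ Sum.inr (Sum.inr (j, i))) :
    Disjoint (closedNbhd (gadgetGraph H z k) u) (pathTail A j) := by
  rw [Finset.disjoint_right]
  rintro (a | s | ⟨j', l⟩) hw
  · exact (inl_notMem_pathTail hw).elim
  · exact (star_notMem_pathTail hw).elim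
  · obtain ⟨rfl, hl⟩ := path_mem_pathTail.1 hw
    rcases u with a | s | ⟨j'', i⟩
    · exact path_mem_nbhd_inl H z k a _
    · rw [path_mem_nbhd_star]
      exact fun h => hl h.2
    · rw [path_mem_nbhd_path]
      rintro ⟨h, -⟩
      exact hu i (by rw [show j' = j'' from h])

theorem disjoint_nbhd_path_gadgetSet {B : Finset (GadgetVertex A k)} (j : Fin k) (i : Fin 5)
    (hx : Sum.inr (Sum.inl 0) ∉ B) (hj : ∀ l, Sum.inr (Sum.inr (j, l)) ∉ B) :
    Disjoint (closedNbhd (gadgetGraph H z k) (Sum.inr (Sum.inr (j, i)))) B := by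
  rw [Finset.disjoint_right]
  rintro (a | s | ⟨j', l⟩) hw
  · exact inl_mem_nbhd_path H z k a _
  · rw [star_mem_nbhd_path]
    rintro ⟨rfl, -⟩
    exact hx hw
  · rw [path_mem_nbhd_path]
    rintro ⟨h, -⟩
    obtain rfl : j' = j := h
    exact hj l hw

/-- Only vertices of the `j`-th path reach its tail, and outside the path they reach nothing but x.
Hence once x is dominated no move acts on both sets. -/
theorem disjoint_nbhd_pathTail_or (B : Finset (GadgetVertex A k)) (j : Fin k)
    (hx : Sum.inr (Sum.inl 0) ∉ B) (hj : ∀ l, Sum.inr (Sum.inr (j, l)) ∉ B)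
    (u : GadgetVertex A k) :
    Disjoint (closedNbhd (gadgetGraph H z k) u) (pathTail A j) ∨
      Disjoint (closedNbhd (gadgetGraph H z k) u) B := by
  by_cases hu : ∀ i, u ≠ Sum.inr (Sum.inr (j, i))
  · exact Or.inl (disjoint_nbhd_pathTail j u hu)
  · push Not at hu
    obtain ⟨i, rfl⟩ := hu
    exact Or.inr (disjoint_nbhd_path_gadgetSet j i hx hj)

theorem not_disjoint_nbhd_pathTail_sdiff {j : Fin k} {i i' : Fin 5} :
    ¬ Disjoint (closedNbhd (gadgetGraph H z k) (Sum.inr (Sum.inr (j, i'))))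
      (pathTail A j \ closedNbhd (gadgetGraph H z k) (Sum.inr (Sum.inr (j, i)))) ↔
    ∃ l, l ≠ 0 ∧ pathNear i' l ∧ ¬ pathNear i l := by
  rw [Finset.not_disjoint_iff]
  constructor
  · rintro ⟨a | s | ⟨j', l⟩, hw, hw'⟩
    · exact (inl_notMem_pathTail (Finset.mem_sdiff.1 hw').1).elim
    · exact (star_notMem_pathTail (Finset.mem_sdiff.1 hw').1).elim
    · rw [Finset.mem_sdiff, path_mem_pathTail, path_mem_nbhd_path] at hw'
      rw [path_mem_nbhd_path] at hw
      exact ⟨l, hw'.1.2, hw.2, fun h => hw'.2 ⟨hw'.1.1, h⟩⟩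
  · rintro ⟨l, h0, h1, h2⟩
    refine ⟨Sum.inr (Sum.inr (j, l)), ?_, ?_⟩
    · rw [path_mem_nbhd_path]
      exact ⟨rfl, h1⟩
    · rw [Finset.mem_sdiff, path_mem_pathTail, path_mem_nbhd_path]
      exact ⟨⟨rfl, h0⟩, fun h => h2 h.2⟩

theorem pathTail_subset_nbhd_union {j : Fin k} {i i' : Fin 5}
    (h : ∀ l, l ≠ 0 → pathNear i l ∨ pathNear i' l) :
    pathTail A j ⊆ closedNbhd (gadgetGraph H z k) (Sum.inr (Sum.inr (j, i))) ∪
      closedNbhd (gadgetGraph H z k) (Sum.inr (Sum.inr (j, i'))) := by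
  rintro (a | s | ⟨j', l⟩) hw
  · exact (inl_notMem_pathTail hw).elim
  · exact (star_notMem_pathTail hw).elim
  · obtain ⟨rfl, hl⟩ := path_mem_pathTail.1 hw
    rw [Finset.mem_union, path_mem_nbhd_path, path_mem_nbhd_path]
    exact (h l hl).imp (fun h => ⟨rfl, h⟩) fun h => ⟨rfl, h⟩

/-- With path vertices 0, ..., 4 and tail 1, ..., 4, finishing answers to the moves 0, 1, 2, 3, 4
are for instance 3, 3, 4, 1, 1. The opening is 2: it leaves only the end vertex 4. -/
theorem isTwoMoveBlock_pathTail (S : Finset (Fin 5)) (j : Fin k) :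
    IsTwoMoveBlock (closedNbhd (gadgetGraph H z k)) (gadgetSet Finset.univ S Finset.univ)
      (pathTail A j) where
  answer := by
    have key : ∀ i : Fin 5, ∃ i', (∃ l, l ≠ 0 ∧ pathNear i' l ∧ ¬ pathNear i l) ∧
        ∀ l, l ≠ 0 → pathNear i l ∨ pathNear i' l := by decide
    intro u _
    by_cases hu : ∀ i, u ≠ Sum.inr (Sum.inr (j, i))
    · have hd := disjoint_nbhd_pathTail (H := H) (z := z) j u hu
      refine ⟨Sum.inr (Sum.inr (j, 1)), by simp, ?_, fun h => (h hd).elim⟩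
      rw [Finset.sdiff_eq_self_of_disjoint hd.symm, Finset.not_disjoint_iff]
      refine ⟨Sum.inr (Sum.inr (j, 1)), ?_, ?_⟩
      · rw [path_mem_nbhd_path]
        exact ⟨rfl, (by decide : pathNear 1 1)⟩
      · rw [path_mem_pathTail]
        exact ⟨rfl, (by decide : (1 : Fin 5) ≠ 0)⟩
    · push Not at hu
      obtain ⟨i, rfl⟩ := hu
      obtain ⟨i', h1, h2⟩ := key i
      exact ⟨Sum.inr (Sum.inr (j, i')), by simp, not_disjoint_nbhd_pathTail_sdiff.2 h1,
        fun _ => pathTail_subset_nbhd_union h2⟩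
  opening := by
    have key : ∀ i' : Fin 5, (∃ l, l ≠ 0 ∧ pathNear i' l ∧ ¬ pathNear 2 l) →
        ∀ l, l ≠ 0 → pathNear 2 l ∨ pathNear i' l := by decide
    refine ⟨Sum.inr (Sum.inr (j, 2)), by simp, ?_, fun u _ hd => ?_⟩
    · rw [Finset.not_disjoint_iff]
      refine ⟨Sum.inr (Sum.inr (j, 1)), ?_, ?_⟩
      · rw [path_mem_nbhd_path]
        exact ⟨rfl, (by decide : pathNear 2 1)⟩
      · rw [path_mem_pathTail]
        exact ⟨rfl, (by decide : (1 : Fin 5) ≠ 0)⟩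
    · by_cases hu : ∀ i, u ≠ Sum.inr (Sum.inr (j, i))
      · exact (hd ((disjoint_nbhd_pathTail j u hu).mono_right Finset.sdiff_subset)).elim
      · push Not at hu
        obtain ⟨i', rfl⟩ := hu
        exact pathTail_subset_nbhd_union (key i' (not_disjoint_nbhd_pathTail_sdiff.1 hd))

/-- Once `x` is dominated, the pendant paths contribute two moves each. -/
theorem endsWithin_union_pathTails_iff (S : Finset (Fin 5)) (J : Finset (Fin k))
    (B : Finset (GadgetVertex A k)) (hx : Sum.inr (Sum.inl 0) ∉ B)
    (hJ : ∀ j ∈ J, ∀ l, Sum.inr (Sum.inr (j, l)) ∉ B) (b : Bool) (n : ℕ) :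
    EndsWithin (DomStep (closedNbhd (gadgetGraph H z k))
        (gadgetSet Finset.univ S Finset.univ)) b (n + 2 * J.card) (B ∪ J.biUnion (pathTail A)) ↔
      EndsWithin (DomStep (closedNbhd (gadgetGraph H z k))
        (gadgetSet Finset.univ S Finset.univ)) b n B := by
  refine endsWithin_union_biUnion_iff J (fun j _ => isTwoMoveBlock_pathTail S j) ?_ ?_ b n
  · intro i _ j _ hij u _
    refine disjoint_nbhd_pathTail_or _ i star_notMem_pathTail (fun l h => hij ?_) u
    exact (path_mem_pathTail.1 h).1
  · intro j hj u _
    exact disjoint_nbhd_pathTail_or B j hx (hJ j hj) u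

/-! ### The two strategies on a gadget graph -/

/-- A lower bound: Staller begins at a leaf next to `x`. -/
theorem not_endsWithin_gadget {S : Finset (Fin 5)} (hS : {4}ᶜ ⊆ S) {t : ℕ}
    (h : ¬ EndsWithin (DomStep (closedNbhd (gadgetGraph H z k))
      (gadgetSet Finset.univ S Finset.univ)) false t (gadgetSet Finset.univ (S \ {0, 1}) ∅)) :
    ¬ EndsWithin (DomStep (closedNbhd (gadgetGraph H z k))
      (gadgetSet Finset.univ S Finset.univ)) true (2 * k + t + 1)
      (gadgetSet Finset.univ S Finset.univ) := by
  have h1 : (1 : Fin 5) ∈ S := hS (by decide)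
  intro hE
  have hleaf : ¬ Disjoint (closedNbhd (gadgetGraph H z k) (Sum.inr (Sum.inl 1)))
      (gadgetSet Finset.univ S Finset.univ) := by
    rw [Finset.not_disjoint_iff]
    refine ⟨Sum.inr (Sum.inl 1), ?_, by simpa using h1⟩
    rw [star_mem_nbhd_star]
    decide
  have hE' := hE _ (domStep_sdiff (by simpa using h1) hleaf)
  have hcard : 2 * k + t = t + 2 * (Finset.univ : Finset (Fin k)).card := by
    rw [Finset.card_univ, Fintype.card_fin, add_comm]
  refine h ((endsWithin_union_pathTails_iff S Finset.univ _ (by simp) (by simp) false t).1 ?_)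
  rw [← hcard]
  -- The path vertices adjacent to x are still undominated; continuation allows them to be dropped,
  -- leaving the core and the tails.
  refine hE'.mono ?_
  have hnear : ∀ s : Fin 5, starNear 1 s → s = 0 ∨ s = 1 := by decide
  rintro (a | s | p) hw
  · rw [Finset.mem_sdiff, inl_mem_nbhd_star]
    exact ⟨by simp, fun h => absurd h.2 (by decide)⟩
  · rw [Finset.mem_sdiff, star_mem_nbhd_star]
    simp only [Finset.mem_union, star_mem_gadgetSet, Finset.mem_biUnion, star_notMem_pathTail,
      and_false, exists_false, or_false, Finset.mem_sdiff, Finset.mem_insert,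
      Finset.mem_singleton] at hw ⊢
    exact ⟨hw.1, fun h => hw.2 (hnear s h)⟩
  · rw [Finset.mem_sdiff, path_mem_nbhd_star]
    exact ⟨by simp, fun h => absurd h.1 (by decide)⟩

/-- An upper bound: Dominator answers Staller's first move at `x`. -/
theorem endsWithin_gadget {S : Finset (Fin 5)} (hS : {4}ᶜ ⊆ S) {t : ℕ}
    (h : EndsWithin (DomStep (closedNbhd (gadgetGraph H z k))
      (gadgetSet Finset.univ S Finset.univ)) true t (gadgetSet {z}ᶜ (S ∩ {4}) ∅))
    (hj : ∀ j : Fin k, ∀ R ∈ ({{2, 3, 4}, {1, 2}} : Finset (Finset (Fin 5))),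
      EndsWithin (DomStep (closedNbhd (gadgetGraph H z k))
        (gadgetSet Finset.univ S Finset.univ)) true (t + 2)
        (gadgetSet {z}ᶜ (S ∩ {4}) ({j} ×ˢ R))) :
    EndsWithin (DomStep (closedNbhd (gadgetGraph H z k))
      (gadgetSet Finset.univ S Finset.univ)) true (2 * k + t + 2)
      (gadgetSet Finset.univ S Finset.univ) := by
  have h0 : (0 : Fin 5) ∈ S := hS (by decide)
  -- The vertex v is the only one of the star part out of reach of x.
  have hnear : ∀ s : Fin 5, ¬ starNear 0 s → s = 4 := by decide
  rintro W ⟨u, -, -, rfl⟩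
  refine EndsWithin.false_of_reply (u := Sum.inr (Sum.inl 0)) (by simpa using h0) ?_
  by_cases hu : ∃ j i, u = Sum.inr (Sum.inr (j, i))
  · obtain ⟨j, i, rfl⟩ := hu
    -- Staller's moves 0, 1, 2 on the path leave subsets of {2, 3, 4} in the tail, and the moves 3,
    -- 4 leave subsets of {1, 2}. By continuation these two sets cover all cases.
    have hR : ∀ i : Fin 5, ∃ R ∈ ({{2, 3, 4}, {1, 2}} : Finset (Finset (Fin 5))), 0 ∉ R ∧
        ∀ l, l ≠ 0 → ¬ pathNear i l → l ∈ R := by decide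
    obtain ⟨R, hR, hR0, hRl⟩ := hR i
    -- The damaged path stays with the core, which is allowed t + 2 moves; the other k - 1 paths
    -- contribute two each. The existence of `j` gives k ≥ 1.
    have hcard : 2 * k + t = (t + 2) + 2 * ({j}ᶜ : Finset (Fin k)).card := by
      rw [Finset.card_compl, Fintype.card_fin, Finset.card_singleton]
      have := j.pos
      omega
    rw [hcard]
    refine ((endsWithin_union_pathTails_iff S {j}ᶜ _ (by simp) ?_ true (t + 2)).2
      (hj j R hR)).mono ?_
    · intro j' hj' l
      rw [path_mem_gadgetSet, Finset.mem_product]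
      exact fun h => Finset.mem_compl.1 hj' h.1
    · rintro (a | s | ⟨j', l⟩) hw
      · simp only [Finset.mem_sdiff, inl_mem_nbhd_star, and_true] at hw
        exact Finset.mem_union_left _ (by simpa using hw.2)
      · simp only [Finset.mem_sdiff, star_mem_nbhd_star, star_mem_gadgetSet] at hw
        exact Finset.mem_union_left _ (by simpa [hnear s hw.2] using hnear s hw.2 ▸ hw.1.1)
      · simp only [Finset.mem_sdiff, path_mem_nbhd_star, path_mem_nbhd_path, true_and] at hw
        by_cases hjj : j' = j
        · subst hjj
          refine Finset.mem_union_left _ ?_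
          simpa using hRl l hw.2 fun hl => hw.1.2 ⟨rfl, hl⟩
        · refine Finset.mem_union_right _ (Finset.mem_biUnion.2 ⟨j', by simpa using hjj, ?_⟩)
          rw [path_mem_pathTail]
          exact ⟨rfl, hw.2⟩
  · have hcard : 2 * k + t = t + 2 * (Finset.univ : Finset (Fin k)).card := by
      rw [Finset.card_univ, Fintype.card_fin, add_comm]
    rw [hcard]
    refine ((endsWithin_union_pathTails_iff S Finset.univ _ (by simp) (by simp) true t).2
      h).mono ?_
    rintro (a | s | ⟨j, l⟩) hw
    · simp only [Finset.mem_sdiff, inl_mem_nbhd_star, and_true] at hw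
      exact Finset.mem_union_left _ (by simpa using hw.2)
    · simp only [Finset.mem_sdiff, star_mem_nbhd_star, star_mem_gadgetSet] at hw
      exact Finset.mem_union_left _ (by simpa [hnear s hw.2] using hnear s hw.2 ▸ hw.1.1)
    · simp only [Finset.mem_sdiff, path_mem_nbhd_star, true_and] at hw
      refine Finset.mem_union_right _ (Finset.mem_biUnion.2 ⟨j, Finset.mem_univ j, ?_⟩)
      rw [path_mem_pathTail]
      exact ⟨rfl, hw.2⟩

end Gadget

/-! ### Masks for the core positions: bits 0-8 base, 9-13 star, 14-18 path -/

/-- The bit that stands for a vertex of a gadget graph; different pendant paths share their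
bits. -/
def gadgetBit (n k : ℕ) : GadgetVertex (Fin n) k → ℕ
  | .inl a => a.val
  | .inr (.inl s) => 9 + s.val
  | .inr (.inr p) => 14 + p.2.val

/-- The mask `m` encodes the closed neighbourhood of `a` in `H`. -/
def IsNbhdMask {n : ℕ} (H : SimpleGraph (Fin n)) (a : Fin n) (m : ℕ) : Prop :=
  ∀ i : Fin 19, m.testBit i.val = true ↔ ∃ b : Fin n, b.val = i.val ∧ (b = a ∨ H.Adj a b)

instance instDecidableIsNbhdMask {n : ℕ} (H : SimpleGraph (Fin n)) [DecidableRel H.Adj]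
    (a : Fin n) (m : ℕ) : Decidable (IsNbhdMask H a m) :=
  inferInstanceAs (Decidable (∀ i : Fin 19, m.testBit i.val = true ↔
    ∃ b : Fin n, b.val = i.val ∧ (b = a ∨ H.Adj a b)))

/-- The masks in `L` encode the closed neighbourhoods in `H`. -/
def AreNbhdMasks {n : ℕ} (H : SimpleGraph (Fin n)) (L : List ℕ) : Prop :=
  (∀ a, ∃ m ∈ L, IsNbhdMask H a m) ∧ ∀ m ∈ L, ∃ a, IsNbhdMask H a m

instance instDecidableAreNbhdMasks {n : ℕ} (H : SimpleGraph (Fin n)) [DecidableRel H.Adj]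
    (L : List ℕ) : Decidable (AreNbhdMasks H L) :=
  inferInstanceAs (Decidable ((∀ a, ∃ m ∈ L, IsNbhdMask H a m) ∧
    ∀ m ∈ L, ∃ a, IsNbhdMask H a m))

/-- The mask `d` encodes the set of vertices with the given parts. -/
def IsGadgetMask {n : ℕ} (B : Finset (Fin n)) (S R : Finset (Fin 5)) (d : ℕ) : Prop :=
  d < 2 ^ 19 ∧ ∀ i : Fin 19, d.testBit i.val = true ↔
    (∃ a ∈ B, a.val = i.val) ∨ (∃ s ∈ S, 9 + s.val = i.val) ∨ ∃ r ∈ R, 14 + r.val = i.val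

instance instDecidableIsGadgetMask {n : ℕ} (B : Finset (Fin n)) (S R : Finset (Fin 5)) (d : ℕ) :
    Decidable (IsGadgetMask B S R d) :=
  inferInstanceAs (Decidable (d < 2 ^ 19 ∧ ∀ i : Fin 19, d.testBit i.val = true ↔
    (∃ a ∈ B, a.val = i.val) ∨ (∃ s ∈ S, 9 + s.val = i.val) ∨ ∃ r ∈ R, 14 + r.val = i.val))

section Masks

variable {n k : ℕ} {H : SimpleGraph (Fin n)} {z : Fin n}

theorem IsNbhdMask.testBit_iff (hn : n ≤ 9) {a : Fin n} {m : ℕ} (h : IsNbhdMask H a m)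
    (b : Fin n) : m.testBit b.val = true ↔ b = a ∨ H.Adj a b := by
  rw [h ⟨b.val, by omega⟩]
  constructor
  · rintro ⟨b', hb, h⟩
    rwa [← Fin.ext hb]
  · exact fun h => ⟨b, rfl, h⟩

theorem IsNbhdMask.testBit_eq_false (hn : n ≤ 9) {a : Fin n} {m : ℕ} (h : IsNbhdMask H a m)
    {i : ℕ} (hi : 9 ≤ i) (hi' : i < 19) : m.testBit i = false := by
  rw [← Bool.not_eq_true, show i = (⟨i, hi'⟩ : Fin 19).val from rfl, h]
  rintro ⟨b, hb, -⟩
  have := b.isLt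
  have : b.val = i := hb
  omega

theorem IsGadgetMask.exists_of_testBit {B : Finset (Fin n)} {S R : Finset (Fin 5)}
    {P : Finset (Fin k × Fin 5)} (hP : P.image Prod.snd = R) {d : ℕ} (h : IsGadgetMask B S R d)
    (i : ℕ) (hi : d.testBit i = true) : ∃ w ∈ gadgetSet B S P, gadgetBit n k w = i := by
  have hi19 : i < 19 := by
    by_contra hge
    have := Nat.testBit_lt_two_pow (h.1.trans_le (Nat.pow_le_pow_right two_pos (not_lt.1 hge)))
    simp [hi] at this
  rcases (h.2 ⟨i, hi19⟩).1 hi with ⟨a, ha, hai⟩ | ⟨s, hs, hsi⟩ | ⟨r, hr, hri⟩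
  · exact ⟨Sum.inl a, by simpa using ha, hai⟩
  · exact ⟨Sum.inr (Sum.inl s), by simpa using hs, hsi⟩
  · rw [← hP, Finset.mem_image] at hr
    obtain ⟨p, hp, rfl⟩ := hr
    exact ⟨Sum.inr (Sum.inr p), by simpa using hp, hri⟩

theorem IsGadgetMask.testBit_of_mem (hn : n ≤ 9) {B : Finset (Fin n)} {S R : Finset (Fin 5)}
    {P : Finset (Fin k × Fin 5)} (hP : P.image Prod.snd = R) {d : ℕ} (h : IsGadgetMask B S R d)
    (w : GadgetVertex (Fin n) k) (hw : w ∈ gadgetSet B S P) :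
    d.testBit (gadgetBit n k w) = true := by
  rcases w with a | s | p
  · exact (h.2 ⟨a.val, by omega⟩).2 (Or.inl ⟨a, by simpa using hw, rfl⟩)
  · exact (h.2 ⟨9 + s.val, by omega⟩).2 (Or.inr (Or.inl ⟨s, by simpa using hw, rfl⟩))
  · refine (h.2 ⟨14 + p.2.val, by omega⟩).2 (Or.inr (Or.inr ⟨p.2, ?_, rfl⟩))
    rw [← hP]
    exact Finset.mem_image_of_mem _ (by simpa using hw)

variable [DecidableRel H.Adj]

/-- Evaluation of the position after Staller's first move at a leaf next to `x`, without the
pendant paths. -/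
theorem endsWithin_leaf_iff_mask (hn : n ≤ 9) {S : Finset (Fin 5)} (hS : {4}ᶜ ⊆ S) {L : List ℕ}
    (hL : AreNbhdMasks H L) {x d : ℕ}
    (hx : ∀ i : Fin 19, x.testBit i.val = true ↔ i.val = z.val ∨ i.val = 11 ∨ i.val = 12)
    (hd : IsGadgetMask (Finset.univ : Finset (Fin n)) (S \ {0, 1}) ∅ d) (b : Bool) (t : ℕ) :
    EndsWithin (DomStep (closedNbhd (gadgetGraph H z k))
      (gadgetSet Finset.univ S Finset.univ)) b t (gadgetSet Finset.univ (S \ {0, 1}) ∅) ↔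
    endsWithinMask (2 ^ 11 :: 3 * 2 ^ 12 :: x :: L) b t d = true := by
  have hbase : ∀ (a : Fin n) (m : ℕ), IsNbhdMask H a m →
      ∀ w ∈ gadgetSet (k := k) Finset.univ (S \ {0, 1}) ∅,
        (m.testBit (gadgetBit n k w) = true ↔
          w ∈ closedNbhd (gadgetGraph H z k) (Sum.inl a)) := by
    rintro a m hm (b | s | p) hw
    · rw [inl_mem_nbhd_inl]
      exact hm.testBit_iff hn b
    · have hs : ¬ (a = z ∧ s = 0) := by
        rintro ⟨-, rfl⟩
        simp at hw
      rw [star_mem_nbhd_inl, gadgetBit, hm.testBit_eq_false hn (by omega) (by omega)]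
      simpa using hs
    · simp at hw
  -- Bits 11 and 12 are the star vertices 2 and 3; the neighbours 0 and 1 are already dominated and
  -- may be left out of the mask.
  have hxz : ∀ w ∈ gadgetSet (k := k) Finset.univ (S \ {0, 1}) ∅,
      (x.testBit (gadgetBit n k w) = true ↔
        w ∈ closedNbhd (gadgetGraph H z k) (Sum.inr (Sum.inl 0))) := by
    have key : ∀ s : Fin 5, s ≠ 0 → s ≠ 1 → (9 + s.val = 11 ∨ 9 + s.val = 12 ↔ starNear 0 s) := by
      decide
    rintro (b | s | p) hw
    · rw [inl_mem_nbhd_star, gadgetBit]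
      refine (hx ⟨b.val, by omega⟩).trans ?_
      rw [Fin.ext_iff]
      show b.val = z.val ∨ b.val = 11 ∨ b.val = 12 ↔ _
      have := b.isLt
      omega
    · rw [star_mem_nbhd_star, gadgetBit]
      refine (hx ⟨9 + s.val, by omega⟩).trans ?_
      have hs : s ≠ 0 ∧ s ≠ 1 := by simp at hw; tauto
      rw [← key s hs.1 hs.2]
      show 9 + s.val = z.val ∨ _ ↔ _
      have := z.isLt
      refine or_iff_right (by omega)
    · simp at hw
  have hstar : ∀ (s : Fin 5) (m : ℕ), s ≠ 0 → (∀ i < 9, m.testBit i = false) →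
      (∀ t : Fin 5, t ≠ 0 → t ≠ 1 → (m.testBit (9 + t.val) = true ↔ starNear s t)) →
      ∀ w ∈ gadgetSet (k := k) Finset.univ (S \ {0, 1}) ∅,
        (m.testBit (gadgetBit n k w) = true ↔
          w ∈ closedNbhd (gadgetGraph H z k) (Sum.inr (Sum.inl s))) := by
    rintro s m hs0 hm hms (b | t | p) hw
    · rw [inl_mem_nbhd_star, gadgetBit, hm b.val (by omega)]
      simp [hs0]
    · rw [star_mem_nbhd_star, gadgetBit]
      have ht : t ≠ 0 ∧ t ≠ 1 := by simp at hw; tauto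
      exact hms t ht.1 ht.2
    · simp at hw
  have h2 := hstar 2 (2 ^ 11) (by decide) (by decide) (by decide)
  have h3 := hstar 3 (3 * 2 ^ 12) (by decide) (by decide) (by decide)
  have h4 := hstar 4 (3 * 2 ^ 12) (by decide) (by decide) (by decide)
  have hPath : (∅ : Finset (Fin k × Fin 5)).image Prod.snd = ∅ := by simp
  refine endsWithin_iff_mask (gadgetBit n k) ?_ ?_ (hd.testBit_of_mem hn hPath)
    (hd.exists_of_testBit hPath) b t
  · rintro (a | s | p) -
    · obtain ⟨m, hm, hma⟩ := hL.1 a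
      exact Or.inr ⟨m, by simp [hm], hbase a m hma⟩
    · have hs : s = 0 ∨ s = 1 ∨ s = 2 ∨ s = 3 ∨ s = 4 := by revert s; decide
      rcases hs with rfl | rfl | rfl | rfl | rfl
      · exact Or.inr ⟨x, by simp, hxz⟩
      · refine Or.inl (Finset.disjoint_right.2 ?_)
        have key : ∀ t : Fin 5, t ≠ 0 → t ≠ 1 → ¬ starNear 1 t := by decide
        rintro (b | t | p) hw
        · rw [inl_mem_nbhd_star]
          simp
        · rw [star_mem_nbhd_star]
          have ht : t ≠ 0 ∧ t ≠ 1 := by simp at hw; tauto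
          exact key t ht.1 ht.2
        · simp at hw
      · exact Or.inr ⟨_, by simp, h2⟩
      · exact Or.inr ⟨_, by simp, h3⟩
      · exact Or.inr ⟨_, by simp, h4⟩
    · exact Or.inl (disjoint_nbhd_path_gadgetSet p.1 p.2 (by simp) (by simp))
  · intro m hm
    simp only [List.mem_cons] at hm
    rcases hm with rfl | rfl | rfl | hm
    · exact ⟨_, by simpa using hS (by decide), h2⟩
    -- The vertices 3 and 4 share a mask here; 3 is the safe witness, since it survives the deletion
    -- of v.
    · exact ⟨_, by simpa using hS (by decide), h3⟩
    · exact ⟨_, by simpa using hS (by decide), hxz⟩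
    · obtain ⟨a, ha⟩ := hL.2 m hm
      exact ⟨Sum.inl a, by simp, hbase a m ha⟩

/-- Evaluation of the positions after Dominator's move at `x`, without the pendant paths in which
nobody has moved. -/
theorem endsWithin_centre_iff_mask (hn : n ≤ 9) {S : Finset (Fin 5)} (hS : {4}ᶜ ⊆ S) {L : List ℕ}
    (hL : AreNbhdMasks H L) {P : Finset (Fin k × Fin 5)} {R : Finset (Fin 5)}
    (hPR : P.image Prod.snd = R) {am : List ℕ} {d : ℕ} (hR : 0 ∉ R)
    (ham : ∀ q : Fin k × Fin 5, (∀ p ∈ P, ¬ (p.1 = q.1 ∧ pathNear q.2 p.2)) ∨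
      ∃ m ∈ am, ∀ p ∈ P, (m.testBit (14 + p.2.val) = true ↔ p.1 = q.1 ∧ pathNear q.2 p.2))
    (ham' : ∀ m ∈ am, ∃ q : Fin k × Fin 5,
      ∀ p ∈ P, (m.testBit (14 + p.2.val) = true ↔ p.1 = q.1 ∧ pathNear q.2 p.2))
    (hlow : ∀ m ∈ am, ∀ i < 14, m.testBit i = false)
    (hd : IsGadgetMask {z}ᶜ (S ∩ {4}) R d) (b : Bool) (t : ℕ) :
    EndsWithin (DomStep (closedNbhd (gadgetGraph H z k))
      (gadgetSet Finset.univ S Finset.univ)) b t (gadgetSet {z}ᶜ (S ∩ {4}) P) ↔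
    endsWithinMask (am ++ (L ++ [2 ^ 13])) b t d = true := by
  have hP0 : ∀ p ∈ P, p.2 ≠ 0 := by
    intro p hp h
    refine hR ?_
    rw [← hPR, ← h]
    exact Finset.mem_image_of_mem _ hp
  have hfour : ∀ s : Fin 5, Sum.inr (Sum.inl s) ∈
      gadgetSet (A := Fin n) (k := k) {z}ᶜ (S ∩ {4}) P → s = 4 := by
    intro s hs
    simp at hs
    exact hs.2
  have hzne : ∀ a : Fin n, Sum.inl a ∈ gadgetSet (k := k) {z}ᶜ (S ∩ {4}) P → a ≠ z := by
    intro a ha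
    simpa using ha
  have hbase : ∀ (a : Fin n) (m : ℕ), IsNbhdMask H a m →
      ∀ w ∈ gadgetSet {z}ᶜ (S ∩ {4}) P, (m.testBit (gadgetBit n k w) = true ↔
          w ∈ closedNbhd (gadgetGraph H z k) (Sum.inl a)) := by
    rintro a m hm (b | s | p) hw
    · rw [inl_mem_nbhd_inl]
      exact hm.testBit_iff hn b
    · obtain rfl := hfour s hw
      rw [star_mem_nbhd_inl, gadgetBit, hm.testBit_eq_false hn (by omega) (by omega)]
      simp
    · rw [gadgetBit, hm.testBit_eq_false hn (by omega) (by omega)]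
      simpa using path_mem_nbhd_inl H z k a p
  have hstar : ∀ s : Fin 5, s = 3 ∨ s = 4 → ∀ w ∈ gadgetSet {z}ᶜ (S ∩ {4}) P,
      ((2 ^ 13).testBit (gadgetBit n k w) = true ↔
          w ∈ closedNbhd (gadgetGraph H z k) (Sum.inr (Sum.inl s))) := by
    intro s hs
    have hs0 : s ≠ 0 := by rintro rfl; revert hs; decide
    have hs4 : starNear s 4 := by rcases hs with rfl | rfl <;> decide
    rintro (b | t | p) hw
    · rw [inl_mem_nbhd_star, gadgetBit, Nat.testBit_two_pow]
      have := b.isLt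
      simp only [hs0, and_false, iff_false, decide_eq_true_eq]
      omega
    · obtain rfl := hfour t hw
      rw [star_mem_nbhd_star]
      exact iff_of_true (show (2 ^ 13).testBit 13 = true by decide) hs4
    · rw [path_mem_nbhd_star, gadgetBit, Nat.testBit_two_pow]
      simp only [hs0, false_and, iff_false, decide_eq_true_eq]
      omega
  have hpath : ∀ (q : Fin k × Fin 5) (m : ℕ), m ∈ am →
      (∀ p ∈ P, (m.testBit (14 + p.2.val) = true ↔ p.1 = q.1 ∧ pathNear q.2 p.2)) →
      ∀ w ∈ gadgetSet {z}ᶜ (S ∩ {4}) P, (m.testBit (gadgetBit n k w) = true ↔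
          w ∈ closedNbhd (gadgetGraph H z k) (Sum.inr (Sum.inr q))) := by
    rintro q m hm hq (b | t | p) hw
    · rw [gadgetBit, hlow m hm _ (by omega)]
      simpa using inl_mem_nbhd_path H z k b q
    · obtain rfl := hfour t hw
      rw [star_mem_nbhd_path, gadgetBit, hlow m hm _ (by decide)]
      simp
    · rw [path_mem_nbhd_path]
      exact hq p (by simpa using hw)
  refine endsWithin_iff_mask (gadgetBit n k) ?_ ?_ (hd.testBit_of_mem hn hPR)
    (hd.exists_of_testBit hPR) b t
  · rintro (a | s | q) -
    · obtain ⟨m, hm, hma⟩ := hL.1 a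
      exact Or.inr ⟨m, by simp [hm], hbase a m hma⟩
    · by_cases hs : s = 3 ∨ s = 4
      · exact Or.inr ⟨_, by simp, hstar s hs⟩
      · refine Or.inl (Finset.disjoint_right.2 ?_)
        have key : ∀ s : Fin 5, ¬ (s = 3 ∨ s = 4) → ¬ starNear s 4 := by decide
        rintro (b | t | p) hw
        · rw [inl_mem_nbhd_star]
          exact fun h => hzne b hw h.1
        · obtain rfl := hfour t hw
          rw [star_mem_nbhd_star]
          exact key s hs
        · rw [path_mem_nbhd_star]
          exact fun h => hP0 p (by simpa using hw) h.2
    · rcases ham q with h | ⟨m, hm, hq⟩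
      · refine Or.inl (Finset.disjoint_right.2 ?_)
        rintro (b | t | p) hw
        · exact inl_mem_nbhd_path H z k b q
        · obtain rfl := hfour t hw
          rw [star_mem_nbhd_path]
          exact fun h => absurd h.1 (by decide)
        · rw [path_mem_nbhd_path]
          exact h p (by simpa using hw)
      · exact Or.inr ⟨m, by simp [hm], hpath q m hm hq⟩
  · intro m hm
    simp only [List.mem_append, List.mem_singleton] at hm
    rcases hm with hm | hm | rfl
    · obtain ⟨q, hq⟩ := ham' m hm
      exact ⟨_, by simp, hpath q m hm hq⟩
    · obtain ⟨a, ha⟩ := hL.2 m hm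
      exact ⟨Sum.inl a, by simp, hbase a m ha⟩
    · exact ⟨_, by simpa using hS (by decide), hstar 3 (Or.inl rfl)⟩

/-- Evaluation of the position after Dominator's answer at `x` to Staller's move in the `j`-th
pendant path, in which the vertices in `R` remain to be dominated. -/
theorem endsWithin_centre_path_iff_mask (hn : n ≤ 9) {S : Finset (Fin 5)} (hS : {4}ᶜ ⊆ S)
    {L : List ℕ} (hL : AreNbhdMasks H L) (j : Fin k) {R : Finset (Fin 5)} {am : List ℕ} {d : ℕ}
    (hR : 0 ∉ R)
    (ham : ∀ i, (∀ r ∈ R, ¬ pathNear i r) ∨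
      ∃ m ∈ am, ∀ r ∈ R, (m.testBit (14 + r.val) = true ↔ pathNear i r))
    (ham' : ∀ m ∈ am, ∃ i, ∀ r ∈ R, (m.testBit (14 + r.val) = true ↔ pathNear i r))
    (hlow : ∀ m ∈ am, ∀ i < 14, m.testBit i = false)
    (hd : IsGadgetMask {z}ᶜ (S ∩ {4}) R d) (b : Bool) (t : ℕ) :
    EndsWithin (DomStep (closedNbhd (gadgetGraph H z k))
      (gadgetSet Finset.univ S Finset.univ)) b t (gadgetSet {z}ᶜ (S ∩ {4}) ({j} ×ˢ R)) ↔
    endsWithinMask (am ++ (L ++ [2 ^ 13])) b t d = true := by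
  have hmem : ∀ p ∈ ({j} ×ˢ R : Finset (Fin k × Fin 5)), p.1 = j ∧ p.2 ∈ R := by
    intro p hp
    simpa using Finset.mem_product.1 hp
  refine endsWithin_centre_iff_mask hn hS hL ?_ hR ?_ ?_ hlow hd b t
  · ext r
    simp
  · rintro ⟨j', i⟩
    by_cases hj : j' = j
    · subst hj
      rcases ham i with h | ⟨m, hm, h⟩
      · exact Or.inl fun p hp hh => h p.2 (hmem p hp).2 hh.2
      · refine Or.inr ⟨m, hm, fun p hp => ?_⟩
        rw [h p.2 (hmem p hp).2]
        exact (and_iff_right (hmem p hp).1).symm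
    · exact Or.inl fun p hp hh => hj (hh.1.symm.trans (hmem p hp).1)
  · intro m hm
    obtain ⟨i, hi⟩ := ham' m hm
    refine ⟨(j, i), fun p hp => ?_⟩
    rw [hi p.2 (hmem p hp).2]
    exact (and_iff_right (hmem p hp).1).symm

/-- The values of the games on a gadget graph and on its vertex-deleted subgraph are determined by
finitely many evaluations. -/
theorem endsWithin_gadget_iff_of_mask (hn : n ≤ 9) {S : Finset (Fin 5)} (hS : {4}ᶜ ⊆ S)
    {L : List ℕ} (hL : AreNbhdMasks H L) {t x d d₀ d₁ d₂ : ℕ}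
    (hx : ∀ i : Fin 19, x.testBit i.val = true ↔ i.val = z.val ∨ i.val = 11 ∨ i.val = 12)
    (hd : IsGadgetMask (Finset.univ : Finset (Fin n)) (S \ {0, 1}) ∅ d)
    (hd₀ : IsGadgetMask {z}ᶜ (S ∩ {4}) ∅ d₀)
    (hd₁ : IsGadgetMask {z}ᶜ (S ∩ {4}) {2, 3, 4} d₁)
    (hd₂ : IsGadgetMask {z}ᶜ (S ∩ {4}) {1, 2} d₂)
    (e : endsWithinMask (2 ^ 11 :: 3 * 2 ^ 12 :: x :: L) false t d = false)
    (e₀ : endsWithinMask (L ++ [2 ^ 13]) true t d₀ = true)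
    (e₁ : endsWithinMask ([3 * 2 ^ 17, 7 * 2 ^ 16, 3 * 2 ^ 16, 2 ^ 16] ++ (L ++ [2 ^ 13]))
      true (t + 2) d₁ = true)
    (e₂ : endsWithinMask ([2 ^ 16, 3 * 2 ^ 15, 2 ^ 15] ++ (L ++ [2 ^ 13])) true (t + 2) d₂ = true) :
    EndsWithin (DomStep (closedNbhd (gadgetGraph H z k))
      (gadgetSet Finset.univ S Finset.univ)) true (2 * k + t + 2)
      (gadgetSet Finset.univ S Finset.univ) ∧
    ¬ EndsWithin (DomStep (closedNbhd (gadgetGraph H z k))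
      (gadgetSet Finset.univ S Finset.univ)) true (2 * k + t + 1)
      (gadgetSet Finset.univ S Finset.univ) := by
  refine ⟨endsWithin_gadget hS ?_ ?_, not_endsWithin_gadget hS ?_⟩
  · exact (endsWithin_centre_iff_mask hn hS hL (am := []) (by simp) (by simp) (by simp) (by simp)
      (by simp) hd₀ true t).2 e₀
  · intro j R hR
    rw [Finset.mem_insert, Finset.mem_singleton] at hR
    rcases hR with rfl | rfl
    · exact (endsWithin_centre_path_iff_mask hn hS hL j (by decide) (by decide) (by decide)
        (by decide) hd₁ true (t + 2)).2 e₁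
    · exact (endsWithin_centre_path_iff_mask hn hS hL j (by decide) (by decide) (by decide)
        (by decide) hd₂ true (t + 2)).2 e₂
  · rw [endsWithin_leaf_iff_mask hn hS hL hx hd, e]
    exact Bool.false_ne_true

end Masks

/-! ### Connectedness -/

theorem connected_of_forall_reachable {V : Type*} {G : SimpleGraph V} (x : V)
    (h : ∀ v, G.Reachable v x) : G.Connected :=
  haveI : Nonempty V := ⟨x⟩
  ⟨fun u v => (h u).trans (h v).symm⟩

theorem gadgetGraph_connected {A : Type*} {H : SimpleGraph A} (hH : H.Connected) (z : A) (k : ℕ) :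
    (gadgetGraph H z k).Connected := by
  have step : ∀ u w, u ≠ w → gadgetRel H z k u w → (gadgetGraph H z k).Reachable u w :=
    fun u w hne h => SimpleGraph.Adj.reachable (SimpleGraph.fromRel_adj _ _ _ |>.2 ⟨hne, Or.inl h⟩)
  have hstar : ∀ s t : Fin 5, s ≠ t →
      (s, t) ∈ [((0 : Fin 5), (1 : Fin 5)), (0, 2), (0, 3), (3, 4)] →
      (gadgetGraph H z k).Reachable (Sum.inr (Sum.inl t)) (Sum.inr (Sum.inl s)) :=
    fun s t hne h => (step (Sum.inr (Sum.inl s)) (Sum.inr (Sum.inl t)) (by simpa using hne) h).symm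
  refine connected_of_forall_reachable (Sum.inr (Sum.inl 0)) ?_
  rintro (a | s | ⟨j, l, hl⟩)
  · let f : H →g gadgetGraph H z k := ⟨Sum.inl, fun {a b} h =>
      SimpleGraph.fromRel_adj _ _ _ |>.2 ⟨by simpa using h.ne, Or.inl h⟩⟩
    exact ((hH.preconnected a z).map f).trans (step _ _ (by simp) ⟨rfl, rfl⟩)
  · have hs : s = 0 ∨ s = 1 ∨ s = 2 ∨ s = 3 ∨ s = 4 := by revert s; decide
    rcases hs with rfl | rfl | rfl | rfl | rfl
    · exact SimpleGraph.Reachable.refl _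
    · exact hstar 0 1 (by decide) (by decide)
    · exact hstar 0 2 (by decide) (by decide)
    · exact hstar 0 3 (by decide) (by decide)
    · exact (hstar 3 4 (by decide) (by decide)).trans (hstar 0 3 (by decide) (by decide))
  · induction l with
    | zero => exact (step (Sum.inr (Sum.inl 0)) (Sum.inr (Sum.inr (j, 0))) (by simp) ⟨rfl, rfl⟩).symm
    | succ l ih =>
      have hl' : l < 5 := by omega
      exact (step (Sum.inr (Sum.inr (j, ⟨l, hl'⟩))) (Sum.inr (Sum.inr (j, ⟨l + 1, hl⟩)))
        (by simp) ⟨rfl, rfl⟩).symm.trans (ih hl')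

theorem attachLeaf_connected {A : Type*} {H : SimpleGraph A} (hH : H.Connected) (z : A) :
    (attachLeaf H z).Connected := by
  refine connected_of_forall_reachable (some z) ?_
  rintro (_ | a)
  · exact SimpleGraph.Adj.reachable (show z = z from rfl)
  · let f : H →g attachLeaf H z := ⟨some, fun {a b} h => h⟩
    exact (hH.preconnected a z).map f

theorem graphZ_connected : graphZ.Connected := by
  have step : ∀ a b : Fin 9, (a, b) ∈ edgesZ → graphZ.Reachable a b :=
    fun a b h => SimpleGraph.Adj.reachable (Or.inl h)
  have h1 := step 0 1 (by decide)
  have h2 := h1.trans (step 1 2 (by decide))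
  have h3 := h2.trans (step 2 3 (by decide))
  have h8 := h3.trans (step 3 8 (by decide))
  have h7 := h8.trans (step 8 7 (by decide))
  have h6 := h7.trans (step 7 6 (by decide))
  have h5 := h6.trans (step 6 5 (by decide))
  have h4 := h7.trans (step 7 4 (by decide))
  refine connected_of_forall_reachable 0 fun v => SimpleGraph.Reachable.symm ?_
  fin_cases v
  exacts [SimpleGraph.Reachable.refl _, h1, h2, h3, h4, h5, h6, h7, h8]

/-! ### Numerical evaluations -/

theorem stallerStartGameDomNumber_eq {V : Type*} [Fintype V] [DecidableEq V] (G : SimpleGraph V)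
    [DecidableRel G.Adj] {t n : ℕ} (hn : t + 1 = n)
    (h : EndsWithin (DomStep (closedNbhd G) Finset.univ) true (t + 1) Finset.univ)
    (h' : ¬ EndsWithin (DomStep (closedNbhd G) Finset.univ) true t Finset.univ) :
    stallerStartGameDomNumber G = n := by
  rw [← stallerStartGameDomNumber_le_iff] at h h'
  omega

theorem stallerStartGameDomNumber_removeVertex_eq {V : Type*} [Fintype V] [DecidableEq V]
    (G : SimpleGraph V) [DecidableRel G.Adj] (v : V) {t n : ℕ} (hn : t + 1 = n)
    (h : EndsWithin (DomStep (closedNbhd G) {v}ᶜ) true (t + 1) {v}ᶜ)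
    (h' : ¬ EndsWithin (DomStep (closedNbhd G) {v}ᶜ) true t {v}ᶜ) :
    stallerStartGameDomNumber (removeVertex G v) = n := by
  rw [← stallerStartGameDomNumber_removeVertex_le_iff] at h h'
  omega

theorem gadgetSet_univ {A : Type*} [Fintype A] {k : ℕ} :
    (gadgetSet Finset.univ Finset.univ Finset.univ : Finset (GadgetVertex A k)) =
      Finset.univ := by
  ext (a | s | p) <;> simp

theorem gadgetSet_compl_four {A : Type*} [Fintype A] [DecidableEq A] {k : ℕ} :
    (gadgetSet Finset.univ {4}ᶜ Finset.univ : Finset (GadgetVertex A k)) = {gadgetV A k}ᶜ := by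
  ext (a | s | p) <;> simp

/-- Eight masks suffice for nine vertices: 4 and 8 have the same closed neighbourhood, with mask
408. -/
theorem areNbhdMasks_graphZ : AreNbhdMasks graphZ [35, 71, 142, 284, 408, 97, 226, 468] := by
  decide +kernel

theorem areNbhdMasks_cycleGraph :
    AreNbhdMasks (SimpleGraph.cycleGraph 6) [35, 7, 14, 28, 56, 49] := by
  decide +kernel

theorem stallerStartGameDomNumber_graphZk (k : ℕ) :
    stallerStartGameDomNumber (graphZk k) = 2 * k + 7 := by
  -- 6400 = 2^8 + 2^11 + 2^12 is the move x, 14847 = 511 + 7·2^11 the position after the leaf, 8447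
  -- = 255 + 2^13 the one after x; the last two add the path sets 7·2^16 and 3·2^15.
  obtain ⟨h, h'⟩ := endsWithin_gadget_iff_of_mask (k := k) (z := (8 : Fin 9)) le_rfl
    (S := Finset.univ) (Finset.subset_univ _) areNbhdMasks_graphZ (t := 5) (x := 6400)
    (d := 14847) (d₀ := 8447) (d₁ := 467199) (d₂ := 106751)
    (by decide +kernel) (by decide +kernel) (by decide +kernel) (by decide +kernel)
    (by decide +kernel) (by decide +kernel) (by decide +kernel) (by decide +kernel)
    (by decide +kernel)
  rw [gadgetSet_univ] at h h'
  exact stallerStartGameDomNumber_eq _ rfl h h'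

theorem stallerStartGameDomNumber_removeVertex_graphZk (k : ℕ) :
    stallerStartGameDomNumber (removeVertex (graphZk k) (gadgetV (Fin 9) k)) = 2 * k + 5 := by
  obtain ⟨h, h'⟩ := endsWithin_gadget_iff_of_mask (k := k) (z := (8 : Fin 9)) le_rfl
    (S := {4}ᶜ) subset_rfl areNbhdMasks_graphZ (t := 3) (x := 6400)
    (d := 6655) (d₀ := 255) (d₁ := 459007) (d₂ := 98559)
    (by decide +kernel) (by decide +kernel) (by decide +kernel) (by decide +kernel)
    (by decide +kernel) (by decide +kernel) (by decide +kernel) (by decide +kernel)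
    (by decide +kernel)
  rw [gadgetSet_compl_four] at h h'
  exact stallerStartGameDomNumber_removeVertex_eq _ _ rfl h h'

theorem stallerStartGameDomNumber_graphWk (z : Fin 6) (k : ℕ) :
    stallerStartGameDomNumber (graphWk z k) = 2 * k + 6 := by
  obtain ⟨h, h'⟩ := endsWithin_gadget_iff_of_mask (k := k) (z := z) (by decide)
    (S := Finset.univ) (Finset.subset_univ _) areNbhdMasks_cycleGraph (t := 4)
    (x := 2 ^ z.val + 6144) (d := 14399) (d₀ := 8255 - 2 ^ z.val) (d₁ := 467007 - 2 ^ z.val)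
    (d₂ := 106559 - 2 ^ z.val)
    (by revert z; decide +kernel) (by decide +kernel) (by revert z; decide +kernel)
    (by revert z; decide +kernel) (by revert z; decide +kernel) (by revert z; decide +kernel)
    (by revert z; decide +kernel) (by revert z; decide +kernel) (by revert z; decide +kernel)
  rw [gadgetSet_univ] at h h'
  exact stallerStartGameDomNumber_eq _ rfl h h'

theorem stallerStartGameDomNumber_removeVertex_graphWk (z : Fin 6) (k : ℕ) :
    stallerStartGameDomNumber (removeVertex (graphWk z k) (gadgetV (Fin 6) k)) = 2 * k + 4 := by
  obtain ⟨h, h'⟩ := endsWithin_gadget_iff_of_mask (k := k) (z := z) (by decide)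
    (S := {4}ᶜ) subset_rfl areNbhdMasks_cycleGraph (t := 2)
    (x := 2 ^ z.val + 6144) (d := 6207) (d₀ := 63 - 2 ^ z.val) (d₁ := 458815 - 2 ^ z.val)
    (d₂ := 98367 - 2 ^ z.val)
    (by revert z; decide +kernel) (by decide +kernel) (by revert z; decide +kernel)
    (by revert z; decide +kernel) (by revert z; decide +kernel) (by revert z; decide +kernel)
    (by revert z; decide +kernel) (by revert z; decide +kernel) (by revert z; decide +kernel)
  rw [gadgetSet_compl_four] at h h'
  exact stallerStartGameDomNumber_removeVertex_eq _ _ rfl h h'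

/-- The bit that stands for a vertex of a graph with an attached leaf. -/
def leafBit {n : ℕ} : Option (Fin n) → ℕ
  | some a => a.val
  | none => n

/-- The set `M` is both the set of moves and the initial position, so that the full graph and the
graph without the leaf are instances. -/
theorem endsWithin_attachLeaf_iff_mask {n : ℕ} {H : SimpleGraph (Fin n)} [DecidableRel H.Adj]
    {z : Fin n} {M : Finset (Option (Fin n))} {ms : List ℕ} {d : ℕ}
    (hms : ∀ u ∈ M, ∃ m ∈ ms, ∀ w ∈ M,
      (m.testBit (leafBit w) = true ↔ w = u ∨ (attachLeaf H z).Adj u w))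
    (hM : ∀ m ∈ ms, ∃ u ∈ M, ∀ w ∈ M,
      (m.testBit (leafBit w) = true ↔ w = u ∨ (attachLeaf H z).Adj u w))
    (hU : ∀ w ∈ M, d.testBit (leafBit w) = true)
    (hd : ∀ i : Fin (n + 1), d.testBit i.val = true → ∃ w ∈ M, leafBit w = i.val)
    (hlt : d < 2 ^ (n + 1)) (b : Bool) (t : ℕ) :
    EndsWithin (DomStep (closedNbhd (attachLeaf H z)) M) b t M ↔
      endsWithinMask ms b t d = true := by
  refine endsWithin_iff_mask leafBit (fun u hu => ?_) (fun m hm => ?_) hU (fun i hi => ?_) b t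
  · obtain ⟨m, hm, h⟩ := hms u hu
    exact Or.inr ⟨m, hm, fun w hw => (h w hw).trans mem_closedNbhd.symm⟩
  · obtain ⟨u, hu, h⟩ := hM m hm
    exact ⟨u, hu, fun w hw => (h w hw).trans mem_closedNbhd.symm⟩
  · refine hd ⟨i, ?_⟩ hi
    by_contra hge
    have := Nat.testBit_lt_two_pow (hlt.trans_le (Nat.pow_le_pow_right two_pos (not_lt.1 hge)))
    simp [hi] at this

theorem stallerStartGameDomNumber_attachLeaf_graphZ :
    stallerStartGameDomNumber (attachLeaf graphZ 8) = 5 := by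
  have key := fun t => endsWithin_attachLeaf_iff_mask (H := graphZ) (z := 8)
    -- The leaf has bit 9. Now 8 has mask 920 = 408 + 512 and the leaf 768 = 256 + 512, while 408
    -- remains the mask of 4.
    (M := Finset.univ) (ms := [35, 71, 142, 284, 408, 97, 226, 468, 920, 768]) (d := 1023)
    (by decide +kernel) (by decide +kernel) (by decide +kernel) (by decide +kernel) (by decide)
    true t
  refine stallerStartGameDomNumber_eq (t := 4) _ rfl ((key _).2 (by decide +kernel)) ?_
  rw [key]
  decide +kernel

theorem stallerStartGameDomNumber_removeVertex_attachLeaf_graphZ :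
    stallerStartGameDomNumber (removeVertex (attachLeaf graphZ 8) none) = 3 := by
  have key := fun t => endsWithin_attachLeaf_iff_mask (H := graphZ) (z := 8)
    (M := {none}ᶜ) (ms := [35, 71, 142, 284, 408, 97, 226, 468]) (d := 511)
    (by decide +kernel) (by decide +kernel) (by decide +kernel) (by decide +kernel) (by decide)
    true t
  refine stallerStartGameDomNumber_removeVertex_eq (t := 2) _ _ rfl
    ((key _).2 (by decide +kernel)) ?_
  rw [key]
  decide +kernel

theorem stallerStartGameDomNumber_attachLeaf_cycleGraph (z : Fin 6) :
    stallerStartGameDomNumber (attachLeaf (SimpleGraph.cycleGraph 6) z) = 4 := by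
  have key := fun t => endsWithin_attachLeaf_iff_mask (H := SimpleGraph.cycleGraph 6) (z := z)
    -- The leaf has bit 6, that is 64; the list is indexed by the vertices of the hexagon, so
    -- `modify` adds the leaf to the neighbourhood of `z`.
    (M := Finset.univ) (ms := (64 + 2 ^ z.val) :: [35, 7, 14, 28, 56, 49].modify z.val (64 + ·))
    (d := 127)
    (by revert z; decide +kernel) (by revert z; decide +kernel) (by decide +kernel)
    (by decide +kernel) (by decide) true t
  refine stallerStartGameDomNumber_eq (t := 3) _ rfl
    ((key _).2 (by clear key; revert z; decide +kernel)) ?_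
  rw [key]
  clear key
  revert z
  decide +kernel

theorem stallerStartGameDomNumber_removeVertex_attachLeaf_cycleGraph (z : Fin 6) :
    stallerStartGameDomNumber
      (removeVertex (attachLeaf (SimpleGraph.cycleGraph 6) z) none) = 2 := by
  have key := fun t => endsWithin_attachLeaf_iff_mask (H := SimpleGraph.cycleGraph 6) (z := z)
    (M := {none}ᶜ) (ms := [35, 7, 14, 28, 56, 49]) (d := 63)
    (by revert z; decide +kernel) (by revert z; decide +kernel) (by decide +kernel)
    (by decide +kernel) (by decide) true t
  refine stallerStartGameDomNumber_removeVertex_eq (t := 1) _ _ rfl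
    ((key _).2 (by decide +kernel)) ?_
  rw [key]
  decide +kernel

theorem mainTheorem10 :
    (∀ l : ℕ, 4 ≤ l →
      ∃ (V : Type) (_ : Fintype V) (_ : DecidableEq V) (G : SimpleGraph V)
        (_ : DecidableRel G.Adj) (v : V),
        G.Connected ∧
        stallerStartGameDomNumber G = l ∧
        stallerStartGameDomNumber (removeVertex G v) = l - 2) ∧
    (∀ k : ℕ,
      (graphZk k).Connected ∧
      stallerStartGameDomNumber (graphZk k) = 2 * k + 7 ∧
      stallerStartGameDomNumber (removeVertex (graphZk k) (gadgetV (Fin 9) k)) = 2 * k + 5) ∧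
    (∀ (z : Fin 6) (k : ℕ),
      (graphWk z k).Connected ∧
      stallerStartGameDomNumber (graphWk z k) = 2 * k + 6 ∧
      stallerStartGameDomNumber (removeVertex (graphWk z k) (gadgetV (Fin 6) k)) = 2 * k + 4) ∧
    (∀ z : Fin 6,
      (attachLeaf (SimpleGraph.cycleGraph 6) z).Connected ∧
      stallerStartGameDomNumber (attachLeaf (SimpleGraph.cycleGraph 6) z) = 4 ∧
      stallerStartGameDomNumber
        (removeVertex (attachLeaf (SimpleGraph.cycleGraph 6) z) none) = 2) ∧
    ((attachLeaf graphZ 8).Connected ∧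
      stallerStartGameDomNumber (attachLeaf graphZ 8) = 5 ∧
      stallerStartGameDomNumber (removeVertex (attachLeaf graphZ 8) none) = 3) := by
  have hC : (SimpleGraph.cycleGraph 6).Connected := SimpleGraph.cycleGraph_connected
  have hZ : ∀ k : ℕ, _ ∧ _ ∧ _ := fun k =>
    ⟨gadgetGraph_connected graphZ_connected 8 k, stallerStartGameDomNumber_graphZk k,
      stallerStartGameDomNumber_removeVertex_graphZk k⟩
  have hW : ∀ (z : Fin 6) (k : ℕ), _ ∧ _ ∧ _ := fun z k =>
    ⟨gadgetGraph_connected hC z k, stallerStartGameDomNumber_graphWk z k,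
      stallerStartGameDomNumber_removeVertex_graphWk z k⟩
  have hCl : ∀ z : Fin 6, _ ∧ _ ∧ _ := fun z =>
    ⟨attachLeaf_connected hC z, stallerStartGameDomNumber_attachLeaf_cycleGraph z,
      stallerStartGameDomNumber_removeVertex_attachLeaf_cycleGraph z⟩
  have hZl := And.intro (attachLeaf_connected graphZ_connected 8)
    (And.intro stallerStartGameDomNumber_attachLeaf_graphZ
      stallerStartGameDomNumber_removeVertex_attachLeaf_graphZ)
  refine ⟨fun l hl => ?_, hZ, hW, hCl, hZl⟩
  -- The families start at 6 and 7 for k = 0; hence 4 and 5 come from the attached leaves, and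
  -- otherwise k = m - 3.
  rcases Nat.even_or_odd' l with ⟨m, rfl | rfl⟩
  · by_cases hm : m = 2
    · subst hm
      exact ⟨_, _, _, _, _, _, hCl 0⟩
    · obtain ⟨k, rfl⟩ : ∃ k, m = k + 3 := ⟨m - 3, by omega⟩
      obtain ⟨h1, h2, h3⟩ := hW 0 k
      exact ⟨_, _, _, graphWk 0 k, _, gadgetV (Fin 6) k, h1, by omega, by omega⟩
  · by_cases hm : m = 2
    · subst hm
      exact ⟨_, _, _, _, _, _, hZl⟩
    · obtain ⟨k, rfl⟩ : ∃ k, m = k + 3 := ⟨m - 3, by omega⟩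
      obtain ⟨h1, h2, h3⟩ := hZ k
      exact ⟨_, _, _, graphZk k, _, gadgetV (Fin 9) k, h1, by omega, by omega⟩
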